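/- A semigroup is finitely based if all its identities can be derived from a finite set of its identities. $A_0^1$ is the monoid obtained by adjoining an identity element to the four-element semigroup $A_0=\langle a,b\mid aa=a,\ bb=b,\ ab=0\rangle$. For a set $W$ of words in the free monoid $\mathfrak A^*$, a subword of a word is a contiguous factor of it, and $S(W)$ is the Rees quotient of $\mathfrak A^*$ over the ideal of all words that are not subwords of words in $W$. Let $\sigma_1$ and $\sigma_2$ denote the identities $xyt_1xt_2y\approx yxt_1xt_2y$ and $xt_1yt_2xy\approx xt_1yt_2yx$. Theorem. Let $W$ be a set of words, at least one of which is non-empty, such that $S(W)$ satisfies $\sigma_1$ and $\sigma_2$. Let $m$ be the maximal integer for which there is a letter $a\in\mathfrak A$ such that $a^m$ is a subword of a word in $W$, with $m=\infty$ if there is no maximal one (thus $m>0$). Then the direct product $A_0^1\times S(W)$ is finitely based if and only if either $m$ is infinite, or $m$ is finite and there is an integer $d$ with $0<d<m+1$ such that, for all letters $b\in\mathfrak A$ and all non-empty words $\mathbf T$ over $\mathfrak A$, the word $b^{m+1-d}\mathbf Tb^d$ is not a subword of any word in $W$. Consequently there is an algorithm which, given a finite set $W$ of words over a countably infinite alphabet,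 at least one of them non-empty, such that $S(W)$ satisfies $\sigma_1$ and $\sigma_2$, decides whether $A_0^1\times S(W)$ is finitely based. -/

import Mathlib

namespace FBMonoid

/-! ## Semigroup identities, derivations, the finite basis property -/

/-- Words over a countably infinite alphabet of variables (elements of the free semigroup). -/
abbrev Word : Type := FreeSemigroup ℕ

/-- A semigroup identity `u ≈ v`, as the pair of its two sides. -/
abbrev Identity : Type := Word × Word

/-- The semigroup `S` satisfies the identity `u ≈ v`: the two sides take the same value under every
substitution of elements of `S` for the variables. -/
def Satisfies (S : Type*) [Semigroup S] (e : Identity) : Prop :=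
  ∀ f : ℕ → S, FreeSemigroup.lift f e.1 = FreeSemigroup.lift f e.2

/-- The equational theory `Eq(S)` of a semigroup `S`. -/
def equationalTheory (S : Type*) [Semigroup S] : Set Identity :=
  {e | Satisfies S e}

/-- `Derives E u v`: the identity `u ≈ v` can be derived from the identities in `E`
(rules of equational logic for semigroups). -/
inductive Derives (E : Set Identity) : Word → Word → Prop
  | ax {u v : Word} : (u, v) ∈ E → Derives E u v
  | refl (u : Word) : Derives E u u
  | symm {u v : Word} : Derives E u v → Derives E v u
  | trans {u v w : Word} : Derives E u v → Derives E v w → Derives E u w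
  | mul {u v u' v' : Word} : Derives E u v → Derives E u' v' → Derives E (u * u') (v * v')
  | subst {u v : Word} (f : ℕ → Word) :
      Derives E u v → Derives E (FreeSemigroup.lift f u) (FreeSemigroup.lift f v)

/-- A set of identities is finitely based if all of its members can be derived from a finite
subset of it. -/
def IsFinitelyBasedSet (E : Set Identity) : Prop :=
  ∃ B : Set Identity, B ⊆ E ∧ B.Finite ∧ ∀ e ∈ E, Derives B e.1 e.2

/-- A semigroup is finitely based if its equational theory is finitely based. -/
def IsFinitelyBased (S : Type*) [Semigroup S] : Prop :=
  IsFinitelyBasedSet (equationalTheory S)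

/-- The variable `n`, as a one-letter word. -/
def var (n : ℕ) : Word := FreeSemigroup.of n

/-- `σ₁`: `x y t₁ x t₂ y ≈ y x t₁ x t₂ y`, with `x, y, t₁, t₂` the variables `0, 1, 2, 3`. -/
def sigma1 : Identity :=
  (var 0 * var 1 * var 2 * var 0 * var 3 * var 1,
   var 1 * var 0 * var 2 * var 0 * var 3 * var 1)

/-- `σ₂`: `x t₁ y t₂ x y ≈ x t₁ y t₂ y x`, with `x, y, t₁, t₂` the variables `0, 1, 2, 3`. -/
def sigma2 : Identity :=
  (var 0 * var 2 * var 1 * var 3 * var 0 * var 1,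
   var 0 * var 2 * var 1 * var 3 * var 1 * var 0)

/-! ## The monoid `A₀¹` -/

/-- The semigroup `A₀ = ⟨a, b ∣ aa = a, bb = b, ab = 0⟩` of order four, with elements
`a`, `b`, `ba` and `0`. -/
inductive A0 : Type
  | a | b | ba | zero

/-- Multiplication table of `A₀`. -/
def A0.mul : A0 → A0 → A0
  | .a, .a => .a
  | .b, .b => .b
  | .b, .a => .ba
  | .b, .ba => .ba
  | .ba, .a => .ba
  | _, _ => .zero

instance : Semigroup A0 where
  mul := A0.mul
  mul_assoc := by rintro (_ | _ | _ | _) (_ | _ | _ | _) (_ | _ | _ | _) <;> rfl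

/-- The monoid `A₀¹`, obtained from `A₀` by adjoining an identity element. -/
abbrev A01 : Type := WithOne A0

/-! ## The monoids `S(W)` -/

variable {α : Type*}

/-- `u` is a subword (a contiguous factor) of `w`. -/
def IsSubword (u w : FreeMonoid α) : Prop :=
  ∃ p q : FreeMonoid α, w = p * u * q

/-- `u` is a subword of some word in `W`. -/
def IsSubwordOf (W : Set (FreeMonoid α)) (u : FreeMonoid α) : Prop :=
  ∃ w ∈ W, IsSubword u w

theorem IsSubwordOf.of_mul {W : Set (FreeMonoid α)} {u p q : FreeMonoid α}
    (h : IsSubwordOf W (p * u * q)) : IsSubwordOf W u := by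
  obtain ⟨w, hw, p', q', rfl⟩ := h
  exact ⟨_, hw, p' * p, q * q', by simp only [mul_assoc]⟩

/-- The Rees congruence on the free monoid modulo the ideal of all words that are not subwords of
words in `W`: it identifies all words of the ideal and nothing else. -/
def reesCon (W : Set (FreeMonoid α)) : Con (FreeMonoid α) where
  r u v := u = v ∨ (¬ IsSubwordOf W u ∧ ¬ IsSubwordOf W v)
  iseqv :=
    { refl := fun _ => Or.inl rfl
      symm := by
        rintro u v (h | ⟨h, h'⟩)
        · exact Or.inl h.symm
        · exact Or.inr ⟨h', h⟩
      trans := by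
        rintro u v w (rfl | ⟨h, h'⟩) (rfl | ⟨k, k'⟩)
        · exact Or.inl rfl
        · exact Or.inr ⟨k, k'⟩
        · exact Or.inr ⟨h, h'⟩
        · exact Or.inr ⟨h, k'⟩ }
  mul' := by
    have left : ∀ {u v : FreeMonoid α}, ¬ IsSubwordOf W u → ¬ IsSubwordOf W (u * v) :=
      fun {u v} h k => h (IsSubwordOf.of_mul (p := 1) (q := v) (by rwa [one_mul]))
    have right : ∀ {u v : FreeMonoid α}, ¬ IsSubwordOf W v → ¬ IsSubwordOf W (u * v) :=
      fun {u v} h k => h (IsSubwordOf.of_mul (p := u) (q := 1) (by rwa [mul_one]))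
    rintro u v u' v' (rfl | ⟨h, h'⟩) (rfl | ⟨k, k'⟩)
    · exact Or.inl rfl
    · exact Or.inr ⟨right k, right k'⟩
    · exact Or.inr ⟨left h, left h'⟩
    · exact Or.inr ⟨left h, left h'⟩

/-- The monoid `S(W)`: the Rees quotient of the free monoid over the ideal of all words that are
not subwords of words in `W`. -/
abbrev SMon (W : Set (FreeMonoid α)) : Type _ := (reesCon W).Quotient

/-- The maximal `k` for which some power `a ^ k` of a letter is a subword of a word in `W`
(infinite if there are arbitrarily large such `k`). -/
noncomputable def maxExponent (W : Set (FreeMonoid α)) : ℕ∞ :=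
  ⨆ k ∈ {k : ℕ | ∃ a : α, IsSubwordOf W (FreeMonoid.of a ^ k)}, (k : ℕ∞)

/-- The set of words listed in `L`. -/
def wordSet (L : List (List ℕ)) : Set (FreeMonoid ℕ) :=
  {w | FreeMonoid.toList w ∈ L}

end FBMonoid

/-! Let M = A₀¹ × S(W). The monoid A₀¹ satisfies u ≈ v exactly when both sides have the same
scattered subwords of length at most two (`A01.valid_iff`). By σ₁ and σ₂, adjacent variables x, y
may be transposed as soon as both occur again to the right, or both to the left. Hence σ₁ and σ₂
imply every identity whose sides agree in multiplicities, in scattered pairs, and in the number of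
occurrences of each variable before every linear (once-occurring) variable
(`SigmaLaws.valid_of_sameShape`).

Sufficiency. Scattered pairs are dictated by the factor A₀¹, so an identity of M can be treated one
variable x at a time. What matters is the vector of exponents of x between the linear variables
inside its span. Identities between such vectors have a finite basis in every monoid: Higman's lemma
yields finitely many lexicographically decreasing rewriting rules (`exists_finset_vecSat`). One case
remains: no linear variable in the span of x, and different multiplicities on the two sides. Both
then exceed m, which is impossible for m = ∞. The projection x^k ≈ x^l is of no use, since repeated
variables may separate the occurrences of x; what is needed is x^(m+1-d) t x^d ≈ x^(m+2-d) t x^d.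
The condition on d provides it: by σ₁ only powers of a letter occur twice without overlap in a
subword of W, so both sides vanish in S(W) unless x is erased.

Necessity. Suppose that for each d some b^(m+1-d) T b^d occurs. For all n the identity x^m y₁² ⋯ yₙ²
x ≈ x^(m+1) y₁² ⋯ yₙ² x holds in M (`valid_chainWord`). An identity s ≈ s' of M with sides of length
at most K, applied to a word that A₀¹ identifies with the left side for n = K + 3, cannot change the
number m + 1 of occurrences of x (`count_preserved`). To do so it would need a variable z occurring
m + 1 times in s, each time contributing one x. The side s is too short to cover the yᵢ by repeated
variables, so a linear t lies between occurrences of z; sending z to b and t to T shows that the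
multiplicity of z is rigid.

For finite W the condition is a bounded search, hence primitive recursive. -/

namespace FBMonoid

/-! ## Identities between words given as lists -/

/-- The monoid `N` satisfies `u ≈ v`, for words given as lists of variables. -/
def Valid (N : Type*) [Monoid N] (u v : List ℕ) : Prop :=
  ∀ f : ℕ → N, (u.map f).prod = (v.map f).prod

namespace Valid

variable {N : Type*} [Monoid N] {u v w u' v' : List ℕ}

theorem refl (u : List ℕ) : Valid N u u := fun _ => rfl

theorem symm (h : Valid N u v) : Valid N v u := fun f => (h f).symm

theorem trans (h : Valid N u v) (h' : Valid N v w) : Valid N u w := fun f => (h f).trans (h' f)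

theorem append (h : Valid N u v) (h' : Valid N u' v') : Valid N (u ++ u') (v ++ v') := fun f => by
  simp [h f, h' f]

theorem append_left (p : List ℕ) (h : Valid N u v) : Valid N (p ++ u) (p ++ v) :=
  (refl p).append h

theorem append_right (q : List ℕ) (h : Valid N u v) : Valid N (u ++ q) (v ++ q) :=
  h.append (refl q)

/-- Deleting variables amounts to substituting 1 for them. -/
theorem filter (p : ℕ → Bool) (h : Valid N u v) : Valid N (u.filter p) (v.filter p) := by
  have key : ∀ (f : ℕ → N) (w : List ℕ),
      ((w.filter p).map f).prod = (w.map fun i => if p i then f i else 1).prod := by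
    intro f w
    induction w with
    | nil => rfl
    | cons a w ih => by_cases h : p a <;> simp [h, ih]
  intro f
  rw [key, key, h]

end Valid

/-! ## The identities of `A₀¹` -/

namespace A01

/-- The generator `a` occurs in the element. -/
def HasA : A01 → Prop
  | some A0.a => True
  | some A0.ba => True
  | _ => False

/-- The generator `b` occurs in the element. -/
def HasB : A01 → Prop
  | some A0.b => True
  | some A0.ba => True
  | _ => False

/-- The zero of `A₀¹`. -/
def zero : A01 := ((A0.zero : A0) : WithOne A0)

theorem cases (x : A01) : x = 1 ∨ x = ((A0.a : A0) : WithOne A0) ∨ x = ((A0.b : A0) : WithOne A0) ∨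
    x = ((A0.ba : A0) : WithOne A0) ∨ x = zero := by
  rcases x with _ | (_ | _ | _ | _)
  · exact Or.inl rfl
  · exact Or.inr (Or.inl rfl)
  · exact Or.inr (Or.inr (Or.inl rfl))
  · exact Or.inr (Or.inr (Or.inr (Or.inl rfl)))
  · exact Or.inr (Or.inr (Or.inr (Or.inr rfl)))

@[simp] theorem hasA_one : ¬ HasA 1 := fun h => h
@[simp] theorem hasA_a : HasA ((A0.a : A0) : WithOne A0) := trivial
@[simp] theorem hasA_b : ¬ HasA ((A0.b : A0) : WithOne A0) := fun h => h
@[simp] theorem hasA_ba : HasA ((A0.ba : A0) : WithOne A0) := trivial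
@[simp] theorem hasA_zero : ¬ HasA zero := fun h => h
@[simp] theorem hasB_one : ¬ HasB 1 := fun h => h
@[simp] theorem hasB_a : ¬ HasB ((A0.a : A0) : WithOne A0) := fun h => h
@[simp] theorem hasB_b : HasB ((A0.b : A0) : WithOne A0) := trivial
@[simp] theorem hasB_ba : HasB ((A0.ba : A0) : WithOne A0) := trivial
@[simp] theorem hasB_zero : ¬ HasB zero := fun h => h
@[simp] theorem one_ne_zero : (1 : A01) ≠ zero := fun h => nomatch h
@[simp] theorem a_ne_zero : ((A0.a : A0) : WithOne A0) ≠ zero := fun h => nomatch h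
@[simp] theorem b_ne_zero : ((A0.b : A0) : WithOne A0) ≠ zero := fun h => nomatch h
@[simp] theorem ba_ne_zero : ((A0.ba : A0) : WithOne A0) ≠ zero := fun h => nomatch h

theorem mul_eq (x y : A0) : (x : WithOne A0) * (y : WithOne A0) = ((A0.mul x y : A0) : WithOne A0) :=
  rfl

theorem mul_eq_zero_iff (x y : A01) : x * y = zero ↔ x = zero ∨ y = zero ∨ (HasA x ∧ HasB y) := by
  rcases cases x with rfl | rfl | rfl | rfl | rfl <;>
  rcases cases y with rfl | rfl | rfl | rfl | rfl <;>
  simp [zero, mul_eq, A0.mul, HasA, HasB]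

theorem hasA_mul (x y : A01) (h : x * y ≠ zero) : HasA (x * y) ↔ HasA x ∨ HasA y := by
  revert h
  rcases cases x with rfl | rfl | rfl | rfl | rfl <;>
  rcases cases y with rfl | rfl | rfl | rfl | rfl <;>
  simp [zero, mul_eq, A0.mul, HasA]

theorem hasB_mul (x y : A01) (h : x * y ≠ zero) : HasB (x * y) ↔ HasB x ∨ HasB y := by
  revert h
  rcases cases x with rfl | rfl | rfl | rfl | rfl <;>
  rcases cases y with rfl | rfl | rfl | rfl | rfl <;>
  simp [zero, mul_eq, A0.mul, HasB]

theorem ext_of_ne_zero {x y : A01} (hx : x ≠ zero) (hy : y ≠ zero) (hA : HasA x ↔ HasA y)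
    (hB : HasB x ↔ HasB y) : x = y := by
  revert hx hy hA hB
  rcases cases x with rfl | rfl | rfl | rfl | rfl <;>
  rcases cases y with rfl | rfl | rfl | rfl | rfl <;>
  simp

theorem prod_ne_zero (f : ℕ → A01) (u : List ℕ) (h : (u.map f).prod ≠ zero) :
    (HasA (u.map f).prod ↔ ∃ x ∈ u, HasA (f x)) ∧ (HasB (u.map f).prod ↔ ∃ x ∈ u, HasB (f x)) := by
  induction u with
  | nil => simp
  | cons a u ih =>
    simp only [List.map_cons, List.prod_cons] at h ⊢
    have h' : (u.map f).prod ≠ zero := fun h0 => h (by rw [mul_eq_zero_iff]; exact Or.inr (Or.inl h0))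
    rw [hasA_mul _ _ h, hasB_mul _ _ h, (ih h').1, (ih h').2]
    simp

theorem prod_eq_zero_iff (f : ℕ → A01) (u : List ℕ) :
    (u.map f).prod = zero ↔
      (∃ x ∈ u, f x = zero) ∨ ∃ x y, [x, y].Sublist u ∧ HasA (f x) ∧ HasB (f y) := by
  induction u with
  | nil => simp
  | cons a u ih =>
    rw [List.map_cons, List.prod_cons, mul_eq_zero_iff, ih]
    by_cases h : (u.map f).prod = zero
    · have h1 := h
      rw [ih] at h1
      constructor
      · intro _
        rcases h1 with ⟨x, hx, h1⟩ | ⟨x, y, hs, h1⟩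
        · exact Or.inl ⟨x, List.mem_cons_of_mem _ hx, h1⟩
        · exact Or.inr ⟨x, y, hs.cons a, h1⟩
      · exact fun _ => Or.inr (Or.inl h1)
    · rw [(prod_ne_zero f u h).2]
      have h1 := h
      rw [ih] at h1
      constructor
      · rintro (h0 | h0 | ⟨hA, y, hy, hB⟩)
        · exact Or.inl ⟨a, by simp, h0⟩
        · exact absurd h0 h1
        · exact Or.inr ⟨a, y, by simpa using hy, hA, hB⟩
      · rintro (⟨x, hx, h0⟩ | ⟨x, y, hs, hA, hB⟩)
        · rcases List.mem_cons.1 hx with rfl | hx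
          · exact Or.inl h0
          · exact absurd (Or.inl ⟨x, hx, h0⟩) h1
        · rcases List.sublist_cons_iff.1 hs with hs | ⟨r, hr, hs⟩
          · exact absurd (Or.inr ⟨x, y, hs, hA, hB⟩) h1
          · simp only [List.cons.injEq] at hr
            obtain ⟨rfl, rfl⟩ := hr
            exact Or.inr (Or.inr ⟨hA, y, by simpa using hs, hB⟩)

/-- `A₀¹` satisfies exactly the identities whose sides have the same scattered subwords of length
at most two. -/
theorem valid_iff (u v : List ℕ) :
    Valid A01 u v ↔ (∀ x, x ∈ u ↔ x ∈ v) ∧ ∀ x y, [x, y].Sublist u ↔ [x, y].Sublist v := by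
  constructor
  · intro h
    have half : ∀ {u v : List ℕ}, Valid A01 u v →
        (∀ x, x ∈ u → x ∈ v) ∧ ∀ x y, [x, y].Sublist u → [x, y].Sublist v := by
      intro u v h
      refine ⟨fun x hx => ?_, fun x y hxy => ?_⟩
      · have := h fun i => if i = x then zero else 1
        have h0 := (prod_eq_zero_iff (fun i => if i = x then zero else 1) u).2
          (Or.inl ⟨x, hx, by simp⟩)
        rw [this, prod_eq_zero_iff] at h0
        rcases h0 with ⟨y, hy, h0⟩ | ⟨y, z, -, h0, -⟩
        · by_cases hyx : y = x
          · exact hyx ▸ hy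
          · simp [hyx] at h0
        · by_cases hyx : y = x <;> simp [hyx] at h0
      -- Only `x` carries the generator `a` and only `y` carries `b` (the value `ba` does both if `x
      -- = y`), so the product vanishes exactly when some `x` precedes some `y`.
      · set f : ℕ → A01 := fun i => if i = x then (if x = y then ((A0.ba : A0) : WithOne A0)
          else ((A0.a : A0) : WithOne A0)) else if i = y then ((A0.b : A0) : WithOne A0) else 1
          with hf
        have fA : ∀ i, HasA (f i) ↔ i = x := by
          intro i
          simp only [hf]
          split_ifs <;> simp_all
        have fB : ∀ i, HasB (f i) ↔ i = y := by
          intro i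
          simp only [hf]
          split_ifs <;> simp_all
        have f0 : ∀ i, f i ≠ zero := by
          intro i
          simp only [hf]
          split_ifs <;> simp
        have h0 := (prod_eq_zero_iff f u).2 (Or.inr ⟨x, y, hxy, (fA x).2 rfl, (fB y).2 rfl⟩)
        rw [h f, prod_eq_zero_iff] at h0
        rcases h0 with ⟨y, hy, h0⟩ | ⟨y, z, hs, h0, h1⟩
        · exact absurd h0 (f0 y)
        · rw [fA] at h0
          rw [fB] at h1
          subst h0 h1
          exact hs
    exact ⟨fun x => ⟨(half h).1 x, (half h.symm).1 x⟩,
      fun x y => ⟨(half h).2 x y, (half h.symm).2 x y⟩⟩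
  · rintro ⟨h1, h2⟩ f
    have hz : (u.map f).prod = zero ↔ (v.map f).prod = zero := by
      rw [prod_eq_zero_iff, prod_eq_zero_iff]
      simp only [h1, h2]
    by_cases hu : (u.map f).prod = zero
    · rw [hu, hz.1 hu]
    · have hv : (v.map f).prod ≠ zero := fun h => hu (hz.2 h)
      apply ext_of_ne_zero hu hv
      · rw [(prod_ne_zero f u hu).1, (prod_ne_zero f v hv).1]
        simp only [h1]
      · rw [(prod_ne_zero f u hu).2, (prod_ne_zero f v hv).2]
        simp only [h1]

end A01


/-! ## Identities with one repeated variable, encoded by vectors of exponents -/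

/-- The product `a ^ n₀ * z₀ * a ^ n₁ * z₁ * ⋯`. -/
def vecVal {N : Type*} [Monoid N] (a : N) (n : List ℕ) (Z : List N) : N :=
  (List.zipWith (fun i z => a ^ i * z) n Z).prod

/-- The monoid `N` satisfies `x ^ n₀ t₀ x ^ n₁ t₁ ⋯ ≈ x ^ n'₀ t₀ x ^ n'₁ t₁ ⋯`. -/
def VecSat (N : Type*) [Monoid N] (n n' : List ℕ) : Prop :=
  n.length = n'.length ∧
    ∀ (a : N) (Z : List N), Z.length = n.length → vecVal a n Z = vecVal a n' Z

namespace VecSat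

variable {N : Type*} [Monoid N] {n n' n'' : List ℕ}

theorem refl (n : List ℕ) : VecSat N n n := ⟨rfl, fun _ _ _ => rfl⟩

theorem symm (h : VecSat N n n') : VecSat N n' n :=
  ⟨h.1.symm, fun a Z hZ => (h.2 a Z (hZ.trans h.1.symm)).symm⟩

theorem trans (h : VecSat N n n') (h' : VecSat N n' n'') : VecSat N n n'' :=
  ⟨h.1.trans h'.1, fun a Z hZ => (h.2 a Z hZ).trans (h'.2 a Z (hZ.trans h.1))⟩

theorem map_vecVal {P : Type*} [Monoid P] (φ : N →* P) (a : N) (n : List ℕ) (Z : List N) :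
    φ (vecVal a n Z) = vecVal (φ a) n (Z.map φ) := by
  induction n generalizing Z with
  | nil => simp [vecVal]
  | cons i n ih =>
    rcases Z with _ | ⟨z, Z⟩
    · simp [vecVal]
    · have := ih Z
      simp only [vecVal, List.map_cons, List.zipWith_cons_cons, List.prod_cons] at this ⊢
      rw [map_mul, map_mul, map_pow, this]

theorem prod {P : Type*} [Monoid P] (h : VecSat N n n') (h' : VecSat P n n') :
    VecSat (N × P) n n' := ⟨h.1, fun a Z hZ => Prod.ext
  (by
    have := h.2 a.1 (Z.map (MonoidHom.fst N P)) (by simpa using hZ)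
    rwa [← MonoidHom.coe_fst, ← map_vecVal, ← map_vecVal] at this)
  (by
    have := h'.2 a.2 (Z.map (MonoidHom.snd N P)) (by simpa using hZ)
    rwa [← MonoidHom.coe_snd, ← map_vecVal, ← map_vecVal] at this)⟩

theorem of_rightInverse {P : Type*} [Monoid P] (φ : N →* P) (ψ : P → N)
    (hψ : ∀ x, φ (ψ x) = x) (h : VecSat N n n') : VecSat P n n' := ⟨h.1, fun a Z hZ => by
  have := congrArg φ (h.2 (ψ a) (Z.map ψ) (by simpa using hZ))
  rw [map_vecVal, map_vecVal, hψ, List.map_map] at this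
  have e : φ ∘ ψ = id := funext hψ
  rwa [e, List.map_id] at this⟩

theorem fst {P : Type*} [Monoid P] (h : VecSat (N × P) n n') : VecSat N n n' :=
  h.of_rightInverse (MonoidHom.fst N P) (fun x => (x, 1)) fun _ => rfl

theorem snd {P : Type*} [Monoid P] (h : VecSat (N × P) n n') : VecSat P n n' :=
  h.of_rightInverse (MonoidHom.snd N P) (fun x => (1, x)) fun _ => rfl

end VecSat

/-- An identity between exponent vectors can be transported along an embedding of vectors,
and decreasing identities stay decreasing. -/
theorem exists_vecSat_of_sublistForall₂ (N : Type*) [Monoid N] {n p : List ℕ} (h : List.SublistForall₂ (· ≤ ·) n p) :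
    ∀ n' : List ℕ, n'.length = n.length → ∃ p' : List ℕ, p'.length = p.length ∧
      (List.Lex (· < ·) n' n → List.Lex (· < ·) p' p) ∧
      ∀ (a : N) (Z : List N), Z.length = p.length →
        ∃ (A : N) (Y : List N), Y.length = n.length ∧
          vecVal a p Z = A * vecVal a n Y ∧ vecVal a p' Z = A * vecVal a n' Y := by
  induction h with
  | @nil l =>
    intro n' hn'
    obtain rfl : n' = [] := by simpa using hn'
    exact ⟨l, rfl, by simp, fun a Z hZ => ⟨vecVal a l Z, [], rfl, by simp [vecVal],
      by simp [vecVal]⟩⟩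
  | @cons b c l₁ l₂ hbc _ ih =>
    rintro (_ | ⟨b', n'⟩) hn'
    · simp at hn'
    obtain ⟨p', hp', hlex, hval⟩ := ih n' (by simpa using hn')
    -- The surplus `c - b` stays in front of the rewritten power, so the comparison of the first
    -- entries is unaffected.
    refine ⟨(b' + (c - b)) :: p', by simp [hp'], fun h => ?_, fun a Z hZ => ?_⟩
    · cases h with
      | cons h =>
        rw [Nat.add_sub_cancel' hbc]
        exact List.Lex.cons (hlex h)
      | rel h => exact List.Lex.rel (by omega)
    · rcases Z with _ | ⟨z, Z⟩
      · simp at hZ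
      obtain ⟨A, Y, hY, h1, h2⟩ := hval a Z (by simpa using hZ)
      refine ⟨a ^ (c - b), (z * A) :: Y, by simp [hY], ?_, ?_⟩
      · have e : a ^ c = a ^ (c - b) * a ^ b := by rw [← pow_add]; congr 1; omega
        simp only [vecVal, List.zipWith_cons_cons, List.prod_cons] at h1 ⊢
        rw [h1, e]
        simp only [mul_assoc]
      · have e : a ^ (b' + (c - b)) = a ^ (c - b) * a ^ b' := by rw [← pow_add, add_comm]
        simp only [vecVal, List.zipWith_cons_cons, List.prod_cons] at h2 ⊢
        rw [h2, e]
        simp only [mul_assoc]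
  | @cons_right c l₁ l₂ _ ih =>
    intro n' hn'
    obtain ⟨p', hp', hlex, hval⟩ := ih n' hn'
    -- An entry skipped by the embedding is kept; its power and the value after it are absorbed into
    -- the factor `A` on the left.
    refine ⟨c :: p', by simp [hp'], fun h => List.Lex.cons (hlex h), fun a Z hZ => ?_⟩
    rcases Z with _ | ⟨z, Z⟩
    · simp at hZ
    obtain ⟨A, Y, hY, h1, h2⟩ := hval a Z (by simpa using hZ)
    refine ⟨a ^ c * z * A, Y, hY, ?_, ?_⟩ <;>
    simp only [vecVal, List.zipWith_cons_cons, List.prod_cons] at h1 h2 ⊢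
    · rw [h1]; simp only [mul_assoc]
    · rw [h2]; simp only [mul_assoc]

/-- Higman's lemma: every set of vectors has a finite subset below all of its elements. -/
theorem exists_finset_sublistForall₂ (I : Set (List ℕ)) :
    ∃ F : Finset (List ℕ), (∀ g ∈ F, g ∈ I) ∧
      ∀ p ∈ I, ∃ g ∈ F, List.SublistForall₂ (· ≤ ·) g p := by
  by_contra hcon
  push Not at hcon
  obtain ⟨f, hf, hr⟩ := exists_seq_of_forall_finset_exists (fun p => p ∈ I)
    (fun g p => ¬ List.SublistForall₂ (· ≤ ·) g p) (fun s hs => hcon s hs)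
  have hpwo : (Set.univ : Set ℕ).PartiallyWellOrderedOn (· ≤ ·) :=
    Set.isPWO_iff_isWF.2 (Set.IsWF.of_wellFoundedLT Set.univ)
  obtain ⟨i, j, hij, h⟩ :=
    (Set.PartiallyWellOrderedOn.partiallyWellOrderedOn_sublistForall₂ (· ≤ ·) hpwo)
      fun i => ⟨f i, by simp⟩
  exact hr i j hij h

/-- The identities between exponent vectors of a monoid have a finite basis. -/
theorem exists_finset_vecSat (M : Type*) [Monoid M] :
    ∃ F : Finset (List ℕ × List ℕ), (∀ g ∈ F, VecSat M g.1 g.2) ∧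
      ∀ (Q : Type*) [Monoid Q], (∀ g ∈ F, VecSat Q g.1 g.2) →
        ∀ n n', VecSat M n n' → VecSat Q n n' := by
  classical
  -- The reducible vectors are those equal in `M` to a lexicographically smaller one. Every
  -- reducible vector lies above a member of `F`, and one rule `g ↦ s g` is chosen for each member.
  obtain ⟨F, hF, hI⟩ := exists_finset_sublistForall₂
    {n | ∃ n', VecSat M n n' ∧ List.Lex (· < ·) n' n}
  choose! s hs hlex using hF
  refine ⟨F.image fun g => (g, s g), ?_, fun Q _ hQ => ?_⟩
  · intro g hg
    obtain ⟨g', hg', rfl⟩ := Finset.mem_image.1 hg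
    exact hs g' hg'
  have hMQ : ∀ g ∈ F, VecSat (M × Q) g (s g) := fun g hg =>
    .prod (hs g hg) (hQ (g, s g) (Finset.mem_image_of_mem _ hg))
  -- Rewriting takes place in `M × Q`: the component `M` makes normal forms comparable, the
  -- component `Q` carries the conclusion. It terminates because rewriting keeps the length and
  -- lowers the vector lexicographically.
  have red : ∀ n, ∃ r, VecSat (M × Q) n r ∧
      ¬ ∃ n', VecSat M r n' ∧ List.Lex (· < ·) n' r := by
    intro n
    induction n using (List.Shortlex.wf (r := fun a b : ℕ => a < b) wellFounded_lt).induction with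
    | _ n ih =>
      by_cases hn : ∃ n', VecSat M n n' ∧ List.Lex (· < ·) n' n
      · obtain ⟨g, hg, hgn⟩ := hI n hn
        obtain ⟨p', hp', hl, hv⟩ :=
          exists_vecSat_of_sublistForall₂ (M × Q) hgn (s g) (hs g hg).1.symm
        have hnp : VecSat (M × Q) n p' := ⟨hp'.symm, fun a Z hZ => by
          obtain ⟨A, Y, hY, h1, h2⟩ := hv a Z hZ
          rw [h1, h2, (hMQ g hg).2 a Y hY]⟩
        obtain ⟨r, hr1, hr2⟩ := ih p' (List.Shortlex.of_lex hp' (hl (hlex g hg)))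
        exact ⟨r, hnp.trans hr1, hr2⟩
      · exact ⟨n, .refl n, hn⟩
  intro n n' h
  obtain ⟨r, h1, h2⟩ := red n
  obtain ⟨r', h1', h2'⟩ := red n'
  have hrr : VecSat M r r' := h1.fst.symm.trans (h.trans h1'.fst)
  -- Of two distinct normal forms equal in `M`, the larger would be reducible.
  have : r = r' := by
    rcases lt_trichotomy r r' with hlt | heq | hlt
    · exact absurd ⟨r, hrr.symm, hlt⟩ h2'
    · exact heq
    · exact absurd ⟨r', hrr, hlt⟩ h2
  subst this
  exact h1.snd.trans h1'.snd.symm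

/-! ## Interleaving powers of a variable with words -/

/-- The word `x ^ n₀ z₀ x ^ n₁ z₁ ⋯`. -/
def inter (x : ℕ) (n : List ℕ) (Z : List (List ℕ)) : List ℕ :=
  (List.zipWith (fun i z => List.replicate i x ++ z) n Z).flatten

theorem prod_map_inter {N : Type*} [Monoid N] (f : ℕ → N) (x : ℕ) (n : List ℕ)
    (Z : List (List ℕ)) :
    ((inter x n Z).map f).prod = vecVal (f x) n (Z.map fun z => (z.map f).prod) := by
  induction n generalizing Z with
  | nil => simp [inter, vecVal]
  | cons i n ih =>
    rcases Z with _ | ⟨z, Z⟩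
    · simp [inter, vecVal]
    · have := ih Z
      simp only [inter, vecVal, List.zipWith_cons_cons, List.flatten_cons, List.map_append,
        List.prod_append, List.map_replicate, List.prod_replicate, List.map_cons,
        List.prod_cons] at this ⊢
      rw [this]

theorem exists_map_eq {N : Type*} (x : ℕ) (a : N) (ts : List ℕ) (hts : ts.Nodup) (hx : x ∉ ts)
    (Z : List N) (hZ : Z.length = ts.length) : ∃ f : ℕ → N, f x = a ∧ ts.map f = Z := by
  induction ts generalizing Z with
  | nil => exact ⟨fun _ => a, rfl, by
      rw [List.length_nil, List.length_eq_zero_iff] at hZ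
      rw [hZ, List.map_nil]⟩
  | cons t ts ih =>
    rcases Z with _ | ⟨z, Z⟩
    · simp at hZ
    simp only [List.nodup_cons, List.mem_cons, not_or] at hts hx
    obtain ⟨f, hf, hf'⟩ := ih hts.2 hx.2 Z (by simpa using hZ)
    refine ⟨Function.update f t z, by rw [Function.update_of_ne hx.1, hf], ?_⟩
    rw [List.map_cons, Function.update_self]
    congr 1
    rw [← hf']
    refine List.map_congr_left fun i hi => ?_
    rw [Function.update_of_ne]
    rintro rfl
    exact hts.1 hi

theorem vecSat_iff_valid {N : Type*} [Monoid N] (x : ℕ) (ts : List ℕ) (hts : ts.Nodup)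
    (hx : x ∉ ts) (n n' : List ℕ) (hn : n.length = ts.length) (hn' : n'.length = ts.length) :
    VecSat N n n' ↔ Valid N (inter x n (ts.map ([·]))) (inter x n' (ts.map ([·]))) := by
  have key : ∀ (f : ℕ → N) n, ((inter x n (ts.map ([·]))).map f).prod
      = vecVal (f x) n (ts.map f) := by
    intro f n
    rw [prod_map_inter, List.map_map]
    congr 1
    simp
  constructor
  · intro h f
    rw [key, key, h.2 _ _ (by simp [hn])]
  · refine fun h => ⟨hn.trans hn'.symm, fun a Z hZ => ?_⟩
    obtain ⟨f, rfl, rfl⟩ := exists_map_eq x a ts hts hx Z (hZ.trans hn)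
    rw [← key, ← key, h]


/-! ## Rearranging words by means of `σ₁` and `σ₂` -/

/-- The monoid satisfies `σ₁` and `σ₂`. -/
structure SigmaLaws (N : Type*) [Monoid N] : Prop where
  left : ∀ x y s t : N, x * y * s * x * t * y = y * x * s * x * t * y
  right : ∀ x y s t : N, x * s * y * t * x * y = x * s * y * t * y * x

theorem A01.sigmaLaws : SigmaLaws A01 where
  left := by
    intro x y s t
    rcases x with _ | (_ | _ | _ | _) <;> rcases y with _ | (_ | _ | _ | _) <;>
    rcases s with _ | (_ | _ | _ | _) <;> rcases t with _ | (_ | _ | _ | _) <;> rfl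
  right := by
    intro x y s t
    rcases x with _ | (_ | _ | _ | _) <;> rcases y with _ | (_ | _ | _ | _) <;>
    rcases s with _ | (_ | _ | _ | _) <;> rcases t with _ | (_ | _ | _ | _) <;> rfl

/-- The order in which the variables recur is immaterial, since `x` and `y` may exchange roles in
σ₁; σ₂ treats recurrence on the left. -/
theorem SigmaLaws.swap {N : Type*} [Monoid N] (hN : SigmaLaws N) {p q : List ℕ} {x y : ℕ}
    (hxy : x ≠ y) (h : (x ∈ q ∧ y ∈ q) ∨ (x ∈ p ∧ y ∈ p)) :
    Valid N (p ++ x :: y :: q) (p ++ y :: x :: q) := by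
  intro f
  rcases h with ⟨hx, hy⟩ | ⟨hx, hy⟩
  · obtain ⟨q₁, q₂, rfl⟩ := List.append_of_mem hx
    rcases List.mem_append.1 hy with hy | hy
    · obtain ⟨q₃, q₄, rfl⟩ := List.append_of_mem hy
      have := congrArg (fun z => (p.map f).prod * z * (q₂.map f).prod)
        (hN.left (f y) (f x) (q₃.map f).prod (q₄.map f).prod)
      simp only [List.map_append, List.map_cons, List.prod_append, List.prod_cons]
      simp only [mul_assoc] at this ⊢
      exact this.symm
    · obtain ⟨q₃, q₄, rfl⟩ := List.append_of_mem ((List.mem_cons.1 hy).resolve_left (Ne.symm hxy))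
      have := congrArg (fun z => (p.map f).prod * z * (q₄.map f).prod)
        (hN.left (f x) (f y) (q₁.map f).prod (q₃.map f).prod)
      simp only [List.map_append, List.map_cons, List.prod_append, List.prod_cons]
      simp only [mul_assoc] at this ⊢
      exact this
  · obtain ⟨q₁, q₂, rfl⟩ := List.append_of_mem hx
    rcases List.mem_append.1 hy with hy | hy
    · obtain ⟨q₃, q₄, rfl⟩ := List.append_of_mem hy
      have := congrArg (fun z => (q₃.map f).prod * z * (q.map f).prod)
        (hN.right (f y) (f x) (q₄.map f).prod (q₂.map f).prod)
      simp only [List.map_append, List.map_cons, List.prod_append, List.prod_cons]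
      simp only [mul_assoc] at this ⊢
      exact this.symm
    · obtain ⟨q₃, q₄, rfl⟩ := List.append_of_mem ((List.mem_cons.1 hy).resolve_left (Ne.symm hxy))
      have := congrArg (fun z => (q₁.map f).prod * z * (q.map f).prod)
        (hN.right (f x) (f y) (q₃.map f).prod (q₄.map f).prod)
      simp only [List.map_append, List.map_cons, List.prod_append, List.prod_cons]
      simp only [mul_assoc] at this ⊢
      exact this

/-- The part of a word before the first occurrence of `t`. -/
def before (t : ℕ) (u : List ℕ) : List ℕ := u.takeWhile (· != t)

theorem before_append_of_mem {t : ℕ} {p q : List ℕ} (h : t ∈ p) :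
    before t (p ++ q) = before t p := by
  induction p with
  | nil => simp at h
  | cons a p ih =>
    by_cases hat : a = t
    · simp [before, hat]
    · have := ih ((List.mem_cons.1 h).resolve_left (Ne.symm hat))
      simp only [before] at this
      simp [before, hat, this]

theorem before_append_of_notMem {t : ℕ} {p q : List ℕ} (h : t ∉ p) :
    before t (p ++ q) = p ++ before t q := by
  induction p with
  | nil => simp
  | cons a p ih =>
    simp only [List.mem_cons, not_or] at h
    have := ih h.2
    simp only [before] at this
    simp [before, Ne.symm h.1, this]

theorem before_append_cons {t : ℕ} {p q : List ℕ} (h : t ∉ p) : before t (p ++ t :: q) = p := by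
  rw [before_append_of_notMem h]
  simp [before]

theorem before_filter {t : ℕ} (P : ℕ → Bool) (ht : P t) (u : List ℕ) :
    before t (u.filter P) = (before t u).filter P := by
  induction u with
  | nil => rfl
  | cons a u ih =>
    simp only [before] at ih
    by_cases hat : a = t
    · subst hat
      simp [before, ht]
    · by_cases ha : P a <;> simp [before, hat, ha, ih]

/-- The variables occur equally often, and equally often before each linear variable, and in the
same mutual order as far as the last occurrence of one variable and the first of another are
concerned. -/
structure SameShape (u v : List ℕ) : Prop where
  count : ∀ x, u.count x = v.count x
  pair : ∀ x y, [x, y].Sublist u ↔ [x, y].Sublist v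
  before : ∀ t, u.count t = 1 → ∀ x, (before t u).count x = (before t v).count x

namespace SameShape

variable {u v w : List ℕ}

theorem symm (h : SameShape u v) : SameShape v u where
  count x := (h.count x).symm
  pair x y := (h.pair x y).symm
  before t ht x := (h.before t ((h.count t).trans ht) x).symm

theorem trans (h : SameShape u v) (h' : SameShape v w) : SameShape u w where
  count x := (h.count x).trans (h'.count x)
  pair x y := (h.pair x y).trans (h'.pair x y)
  before t ht x := (h.before t ht x).trans (h'.before t ((h.count t).symm.trans ht) x)

theorem swap {p q : List ℕ} {x y : ℕ} (hxy : x ≠ y) (h : (x ∈ q ∧ y ∈ q) ∨ (x ∈ p ∧ y ∈ p)) :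
    SameShape (p ++ x :: y :: q) (p ++ y :: x :: q) where
  count := fun z => List.Perm.count_eq ((List.Perm.swap _ _ _).append_left _) z
  -- A₀¹ satisfies σ₁ and σ₂ itself, so such a transposition cannot change the scattered pairs.
  pair := ((A01.valid_iff _ _).1 (A01.sigmaLaws.swap hxy h)).2
  before := by
    intro t ht z
    by_cases htp : t ∈ p
    · rw [before_append_of_mem htp, before_append_of_mem htp]
    · have htx : x ≠ t := by
        rintro rfl
        have := h.resolve_right fun h => htp h.1
        have := List.count_pos_iff.2 this.1
        rw [List.count_append, List.count_cons_self] at ht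
        have := (List.sublist_cons_self y q).count_le x
        omega
      have hty : y ≠ t := by
        rintro rfl
        have := h.resolve_right fun h => htp h.2
        have := List.count_pos_iff.2 this.2
        rw [List.count_append, List.count_cons_of_ne hxy, List.count_cons_self] at ht
        omega
      rw [before_append_of_notMem htp, before_append_of_notMem htp]
      have e1 : FBMonoid.before t (x :: y :: q) = x :: y :: FBMonoid.before t q := by
        simp [FBMonoid.before, htx, hty]
      have e2 : FBMonoid.before t (y :: x :: q) = y :: x :: FBMonoid.before t q := by
        simp [FBMonoid.before, htx, hty]
      rw [e1, e2]
      exact List.Perm.count_eq ((List.Perm.swap _ _ _).append_left _) z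

end SameShape

theorem pair_sublist_append {x y : ℕ} {p q : List ℕ} (hx : x ∈ p) (hy : y ∈ q) :
    [x, y].Sublist (p ++ q) :=
  (List.singleton_sublist.2 hx).append (List.singleton_sublist.2 hy)

theorem not_pair_sublist {x y : ℕ} {p q : List ℕ} (hx : x ∉ p) (hy : y ∉ q) :
    ¬ [x, y].Sublist (p ++ q) := by
  intro h
  obtain ⟨l₁, l₂, e, h1, h2⟩ := List.sublist_append_iff.1 h
  rcases l₁ with _ | ⟨a, l⟩
  · simp only [List.nil_append] at e
    subst e
    exact hy (h2.subset (by simp))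
  · simp only [List.cons_append, List.cons.injEq] at e
    obtain ⟨rfl, -⟩ := e
    exact hx (h1.subset (by simp))

/-- An occurrence of `y` before the first occurrence of `c` can be moved behind it, if this brings
the word closer to one that has the same shape. -/
theorem mem_of_sameShape {r p q v : List ℕ} {y c : ℕ} (hyc : y ≠ c) (hcp : c ∉ p)
    (h : SameShape (r ++ (p ++ y :: c :: q)) (r ++ c :: v)) :
    (y ∈ q ∧ c ∈ q) ∨ (y ∈ r ++ p ∧ c ∈ r ++ p) := by
  by_contra hcon
  rw [not_or, not_and_or, not_and_or] at hcon
  have hcy := Ne.symm hyc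
  have count_y := h.count y
  have count_c := h.count c
  simp only [List.count_append, List.count_cons_self, List.count_cons_of_ne hyc,
    List.count_cons_of_ne hcy, List.count_eq_zero_of_not_mem hcp] at count_y count_c
  -- The transposition is forbidden in four cases, each excluded by one clause of the shape: `y` is
  -- linear and would precede `c`; the last `y` precedes the first `c`; the last `c` follows the
  -- first `y` immediately; `c` is linear.
  rcases hcon with ⟨hy | hc, hy' | hc'⟩
  · have hyr : y ∉ r := fun h => hy' (List.mem_append_left _ h)
    have hyp : y ∉ p := fun h => hy' (List.mem_append_right _ h)
    have := h.before y (by simp [List.count_eq_zero_of_not_mem, hy, hyr, hyp, hcy]) c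
    rw [← List.append_assoc, before_append_cons hy', before_append_of_notMem hyr,
      ← List.singleton_append, before_append_of_notMem (by simpa using hyc)] at this
    simp only [List.count_append, List.count_singleton_self,
      List.count_eq_zero_of_not_mem hcp] at this
    omega
  · have hcr : c ∉ r := fun h => hc' (List.mem_append_left _ h)
    have hyv : y ∈ v := List.count_pos_iff.1 (by omega)
    have h1 := (h.pair c y).2 (((List.singleton_sublist.2 hyv).cons_cons c).trans
      (List.sublist_append_right _ _))
    rw [← List.append_assoc, List.append_cons] at h1
    exact not_pair_sublist (by simp [hcr, hcp, hcy]) (by simp [hy, hyc]) h1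
  · have hyr : y ∉ r := fun h => hy' (List.mem_append_left _ h)
    have hcv : c ∉ v := by
      rw [← List.count_eq_zero]
      rw [List.count_eq_zero_of_not_mem hc] at count_c
      omega
    have h1 := (h.pair y c).1 (((by simp : [y, c].Sublist (y :: c :: q)).trans
      (List.sublist_append_right _ _)).trans (List.sublist_append_right _ _))
    rw [List.append_cons] at h1
    exact not_pair_sublist (by simp [hyr, hyc]) hcv h1
  · have hcr : c ∉ r := fun h => hc' (List.mem_append_left _ h)
    have := h.before c (by simp [List.count_eq_zero_of_not_mem, hc, hcr, hcp, hyc]) y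
    rw [before_append_cons hcr, ← List.append_assoc, ← List.singleton_append, ← List.append_assoc,
      before_append_cons (by simp [hcr, hcp, hcy])] at this
    simp only [List.count_append, List.count_singleton_self] at this
    omega

theorem SigmaLaws.moveFront {N : Type*} [Monoid N] (hN : SigmaLaws N) {r v : List ℕ} {c : ℕ}
    (p : List ℕ) : ∀ q, c ∉ p → SameShape (r ++ (p ++ c :: q)) (r ++ c :: v) →
      Valid N (r ++ (p ++ c :: q)) (r ++ c :: (p ++ q)) ∧
        SameShape (r ++ c :: (p ++ q)) (r ++ c :: v) := by
  induction p using List.reverseRecOn with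
  | nil => exact fun q _ h => ⟨.refl _, h⟩
  | append_singleton p y ih =>
    intro q hc h
    simp only [List.mem_append, List.mem_singleton, not_or] at hc
    have hyc : y ≠ c := Ne.symm hc.2
    simp only [List.append_assoc, List.cons_append, List.nil_append] at h ⊢
    have hmem := mem_of_sameShape hyc hc.1 h
    have h1 := hN.swap hyc hmem
    have h2 := SameShape.swap hyc hmem
    simp only [List.append_assoc] at h1 h2
    have h3 := ih (y :: q) hc.1 (h2.symm.trans h)
    exact ⟨h1.trans h3.1, h3.2⟩

/-- The target is built letter by letter: its next letter `c` is brought forward past letters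
different from `c`, each transposition being allowed by `mem_of_sameShape` and preserving the shape.
-/
theorem SigmaLaws.valid_of_sameShape {N : Type*} [Monoid N] (hN : SigmaLaws N) {u v : List ℕ}
    (h : SameShape u v) : Valid N u v := by
  suffices H : ∀ v r u : List ℕ, SameShape (r ++ u) (r ++ v) → Valid N (r ++ u) (r ++ v) from
    H v [] u h
  intro v
  induction v with
  | nil =>
    intro r u h
    have := (List.perm_iff_count.2 h.count).length_eq
    have : u = [] := by simpa using this
    rw [this]
    exact .refl _
  | cons c v ih =>
    intro r u h
    have hc : c ∈ u := by
      have := h.count c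
      simp only [List.count_append, List.count_cons_self] at this
      exact List.count_pos_iff.1 (by omega)
    obtain ⟨p, q, rfl, hp⟩ := List.eq_append_cons_of_mem hc
    obtain ⟨h1, h2⟩ := hN.moveFront p q hp h
    have := ih (r ++ [c]) (p ++ q) (by simpa using h2)
    exact h1.trans (by simpa using this)


/-! ## Reduction to identities with one repeated variable -/

theorem two_le_count_iff {x : ℕ} {u : List ℕ} : 2 ≤ u.count x ↔ [x, x].Sublist u :=
  List.replicate_sublist_iff.symm

theorem A01.count_eq_one {u v : List ℕ} (h : Valid A01 u v) {t : ℕ} (ht : u.count t = 1) :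
    v.count t = 1 := by
  rw [valid_iff] at h
  have h1 := List.count_pos_iff.2 ((h.1 t).1 (List.count_pos_iff.1 (by omega)))
  have h2 : ¬ 2 ≤ v.count t := fun h2 => by
    rw [two_le_count_iff, ← h.2, ← two_le_count_iff] at h2
    omega
  omega

theorem exists_eq_append_of_count_eq_one {t : ℕ} {u : List ℕ} (h : u.count t = 1) :
    ∃ p q, u = p ++ t :: q ∧ t ∉ p ∧ t ∉ q := by
  obtain ⟨p, q, rfl, hp⟩ := List.eq_append_cons_of_mem (List.count_pos_iff.1 (by omega : 0 < u.count t))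
  refine ⟨p, q, rfl, hp, fun hq => ?_⟩
  have := List.count_pos_iff.2 hq
  rw [List.count_append, List.count_cons_self] at h
  omega

theorem count_before_eq_zero {x t : ℕ} {u : List ℕ} (ht : u.count t = 1)
    (h : ¬ [x, t].Sublist u) : (before t u).count x = 0 := by
  obtain ⟨p, q, rfl, hp, hq⟩ := exists_eq_append_of_count_eq_one ht
  rw [before_append_cons hp, List.count_eq_zero]
  exact fun hx => h (pair_sublist_append hx (by simp))

theorem count_before_eq_count {x t : ℕ} {u : List ℕ} (hxt : t ≠ x) (ht : u.count t = 1)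
    (h : ¬ [t, x].Sublist u) : (before t u).count x = u.count x := by
  obtain ⟨p, q, rfl, hp, hq⟩ := exists_eq_append_of_count_eq_one ht
  have : x ∉ q := fun hx => h (by
    rw [List.append_cons]
    exact pair_sublist_append (by simp) hx)
  simp [before_append_cons hp, hxt, List.count_eq_zero_of_not_mem this]

theorem two_le_count_of_pairs {x t : ℕ} {u : List ℕ} (hxt : t ≠ x) (ht : u.count t = 1)
    (h1 : [x, t].Sublist u) (h2 : [t, x].Sublist u) : 2 ≤ u.count x := by
  obtain ⟨p, q, rfl, hp, hq⟩ := exists_eq_append_of_count_eq_one ht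
  have hx : x ∈ p := by
    by_contra hx
    rw [List.append_cons] at h1
    exact not_pair_sublist (by simp [hx, Ne.symm hxt]) hq h1
  have hx' : x ∈ q := by
    by_contra hx'
    exact not_pair_sublist hp (by simp [hx', Ne.symm hxt]) h2
  rw [two_le_count_iff]
  exact pair_sublist_append hx (List.mem_cons_of_mem _ hx')

/-- The variable `x` occurs equally often in both words, and equally often before each linear
variable. -/
def Agree (u v : List ℕ) (x : ℕ) : Prop :=
  u.count x = v.count x ∧ ∀ t, u.count t = 1 → (before t u).count x = (before t v).count x

/-- A linear variable outside the span of `x` has none or all occurrences of `x` before it, and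
scattered pairs decide which. Only linear variables inside the span need to survive the filter. -/
theorem agree_of_filter {u v : List ℕ} (h : Valid A01 u v) (x : ℕ) (P : ℕ → Bool) (hx : P x)
    (hP : ∀ t, u.count t = 1 → [x, t].Sublist u → [t, x].Sublist u → P t)
    (huv : u.filter P = v.filter P) : Agree u v x := by
  have hcount : u.count x = v.count x := by
    rw [← List.count_filter hx, huv, List.count_filter hx]
  refine ⟨hcount, fun t ht => ?_⟩
  have ht' := A01.count_eq_one h ht
  by_cases htx : t = x
  · subst htx
    obtain ⟨p, q, rfl, hp, -⟩ := exists_eq_append_of_count_eq_one ht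
    obtain ⟨p', q', rfl, hp', -⟩ := exists_eq_append_of_count_eq_one ht'
    rw [before_append_cons hp, before_append_cons hp', List.count_eq_zero_of_not_mem hp,
      List.count_eq_zero_of_not_mem hp']
  by_cases h1 : [x, t].Sublist u
  · by_cases h2 : [t, x].Sublist u
    · have hPt := hP t ht h1 h2
      rw [← List.count_filter hx, ← before_filter P hPt, huv, before_filter P hPt,
        List.count_filter hx]
    · rw [count_before_eq_count htx ht h2,
        count_before_eq_count htx ht' (by rwa [← ((A01.valid_iff _ _).1 h).2]), hcount]
  · rw [count_before_eq_zero ht h1,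
      count_before_eq_zero ht' (by rwa [← ((A01.valid_iff _ _).1 h).2])]

theorem Agree.of_filter_ne {u u' v : List ℕ} {x y : ℕ} (hyx : y ≠ x) (hx : u'.count x ≠ 1)
    (h : u'.filter (· != x) = u.filter (· != x)) (hy : Agree u v y) : Agree u' v y := by
  have key : ∀ z, z ≠ x → ∀ w : List ℕ, w.count z = (w.filter (· != x)).count z :=
    fun z hz w => (List.count_filter (by simpa using hz)).symm
  refine ⟨by rw [key y hyx, h, ← key y hyx, hy.1], fun t ht => ?_⟩
  have htx : t ≠ x := by
    rintro rfl
    exact hx ht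
  rw [key t htx, h, ← key t htx] at ht
  rw [← hy.2 t ht, key y hyx, ← before_filter _ (by simpa using htx), h,
    before_filter _ (by simpa using htx), ← key y hyx]

/-- The two outer occurrences of `x` already witness every pair that an inner one could contribute.
-/
theorem A01.valid_filter_ne (x : ℕ) (U : List ℕ) :
    Valid A01 (x :: (U ++ [x])) (x :: (U.filter (· != x) ++ [x])) := by
  rw [valid_iff]
  refine ⟨fun y => ?_, fun y z => ⟨fun h => ?_, fun h => h.trans ?_⟩⟩
  · by_cases hy : y = x <;> simp [hy]
  · by_cases hy : y = x
    · subst hy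
      have hz : z ∈ U ++ [y] := by
        rcases List.sublist_cons_iff.1 h with h | ⟨r, hr, h⟩
        · exact h.subset (by simp)
        · simp only [List.cons.injEq, true_and] at hr
          subst hr
          simpa using h
      have : z ∈ U.filter (· != y) ++ [y] := by
        by_cases hz' : z = y
        · simp [hz']
        · simpa [hz'] using hz
      exact (List.singleton_sublist.2 this).cons_cons y
    · by_cases hz : z = x
      · subst hz
        have : y ∈ U := by
          have := h.subset (show y ∈ [y, z] by simp)
          simpa [hy] using this
        exact List.Sublist.cons z (pair_sublist_append (by simpa [hy] using this) (by simp))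
      · have := h.filter (· != x)
        simp only [bne_iff_ne, ne_eq, hy, not_false_eq_true, List.filter_cons_of_pos, hz,
          List.filter_nil, bne_self_eq_false, Bool.false_eq_true, List.filter_cons_of_neg,
          List.filter_append, List.append_nil] at this
        exact (this.trans (List.sublist_append_left _ _)).cons x
  · exact ((List.filter_sublist).append_right _).cons_cons _

theorem A01.valid_of_filter_ne {x : ℕ} {U U' : List ℕ} (P S : List ℕ)
    (h : U.filter (· != x) = U'.filter (· != x)) :
    Valid A01 (P ++ x :: (U ++ [x]) ++ S) (P ++ x :: (U' ++ [x]) ++ S) := by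
  refine Valid.append_right _ (Valid.append_left _ ?_)
  have := valid_filter_ne x U
  rw [h] at this
  exact this.trans (valid_filter_ne x U').symm

/-- Moving inner occurrences of `x` leaves the A₀¹-pairs and the other variables alone. If in
addition the projections to `x` and the linear variables of its span coincide, the two words have
the same shape. -/
theorem SigmaLaws.valid_of_filter_ne {N : Type*} [Monoid N] (hN : SigmaLaws N) {x : ℕ}
    {U U' : List ℕ} (P S : List ℕ) (h : U.filter (· != x) = U'.filter (· != x)) (p : ℕ → Bool)
    (hx : p x) (hp : ∀ t ∈ U, (P ++ x :: (U ++ [x]) ++ S).count t = 1 → p t)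
    (hU : (P ++ x :: (U ++ [x]) ++ S).filter p = (P ++ x :: (U' ++ [x]) ++ S).filter p)
    (hPx : x ∉ P) (hSx : x ∉ S) :
    Valid N (P ++ x :: (U ++ [x]) ++ S) (P ++ x :: (U' ++ [x]) ++ S) := by
  have hA := A01.valid_of_filter_ne P S h
  have htU : ∀ t, (P ++ x :: (U ++ [x]) ++ S).count t = 1 →
      [x, t].Sublist (P ++ x :: (U ++ [x]) ++ S) → [t, x].Sublist (P ++ x :: (U ++ [x]) ++ S) →
      t ∈ U := by
    intro t ht h1 h2
    have h3 : t ∈ P ++ x :: (U ++ [x]) ++ S := h1.subset (by simp)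
    have h4 : t ≠ x := by
      rintro rfl
      simp at ht
      omega
    simp only [List.mem_append, List.mem_cons, h4, List.not_mem_nil, or_false, false_or] at h3
    rcases h3 with (h3 | h3) | h3
    · have : t ∉ x :: (U ++ [x]) ++ S := by
        rw [← List.count_eq_zero]
        have := List.count_pos_iff.2 h3
        rw [List.append_assoc, List.count_append] at ht
        omega
      rw [List.append_assoc] at h1
      exact absurd h1 (not_pair_sublist hPx this)
    · exact h3
    · have : t ∉ P ++ x :: (U ++ [x]) := by
        rw [← List.count_eq_zero]
        have := List.count_pos_iff.2 h3
        rw [List.count_append] at ht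
        omega
      exact absurd h2 (not_pair_sublist this hSx)
  have hag := agree_of_filter hA x p hx (fun t ht h1 h2 => hp t (htU t ht h1 h2) ht) hU
  have hfil : (P ++ x :: (U ++ [x]) ++ S).filter (· != x)
      = (P ++ x :: (U' ++ [x]) ++ S).filter (· != x) := by
    simp only [List.filter_append, List.filter_cons, h]
  have hag' : ∀ y, Agree (P ++ x :: (U ++ [x]) ++ S) (P ++ x :: (U' ++ [x]) ++ S) y := by
    intro y
    by_cases hyx : y = x
    · exact hyx ▸ hag
    · refine Agree.of_filter_ne hyx ?_ hfil ⟨rfl, fun t _ => rfl⟩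
      simp
      omega
  exact hN.valid_of_sameShape ⟨fun y => (hag' y).1, ((A01.valid_iff _ _).1 hA).2,
    fun t ht y => (hag' y).2 t ht⟩

/-! ### Cutting words into chunks -/

/-- Each chunk ends with its kept letter, except that the last one also absorbs the tail; with no
kept letter there would be no chunk to hold it. -/
theorem exists_chunks (p : ℕ → Bool) (O ts : List ℕ) (h : O.filter p = ts) (hts : ts ≠ []) :
    ∃ Z : List (List ℕ), Z.flatten = O ∧ Z.map (List.filter p) = ts.map ([·]) := by
  induction ts generalizing O with
  | nil => exact absurd rfl hts
  | cons t ts ih =>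
    obtain ⟨l₁, l₂, rfl, h1, h2, h3⟩ := List.filter_eq_cons_iff.1 h
    have h1' : l₁.filter p = [] := List.filter_eq_nil_iff.2 h1
    rcases eq_or_ne ts [] with rfl | hne
    · exact ⟨[l₁ ++ t :: l₂], by simp, by simp [h1', h2, h3]⟩
    · obtain ⟨Z, hZ, hZ'⟩ := ih l₂ h3 hne
      exact ⟨(l₁ ++ [t]) :: Z, by simp [hZ], by simp [h1', h2, hZ']⟩

theorem exists_eq_inter (x : ℕ) (w ts : List ℕ) (h : w.filter (· != x) = ts) :
    ∃ (l : List ℕ) (b : ℕ), l.length = ts.length ∧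
      w = inter x l (ts.map ([·])) ++ List.replicate b x := by
  induction ts generalizing w with
  | nil =>
    refine ⟨[], w.length, rfl, ?_⟩
    simp only [inter, List.zipWith_nil_left, List.flatten_nil, List.nil_append]
    refine List.eq_replicate_length.2 fun y hy => ?_
    have := List.filter_eq_nil_iff.1 h y hy
    simpa using this
  | cons t ts ih =>
    obtain ⟨l₁, l₂, rfl, h1, h2, h3⟩ := List.filter_eq_cons_iff.1 h
    obtain ⟨l, b, hl, hw⟩ := ih l₂ h3
    refine ⟨l₁.length :: l, b, by simp [hl], ?_⟩
    have : l₁ = List.replicate l₁.length x := List.eq_replicate_length.2 fun y hy => by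
      simpa using h1 y hy
    simp only [inter] at hw
    simp only [inter, List.map_cons, List.zipWith_cons_cons, List.flatten_cons, ← this,
      List.append_assoc]
    rw [← hw]
    simp

theorem inter_ends (x k b : ℕ) (mid : List ℕ) (Z : List (List ℕ)) (h : mid.length + 1 = Z.length) :
    inter x ((k + 1) :: mid ++ [b + 1]) (Z ++ [[]]) =
      x :: (inter x (k :: mid) Z ++ List.replicate b x ++ [x]) := by
  unfold inter
  rw [List.zipWith_append (by simpa using h)]
  rcases Z with _ | ⟨z, Z⟩
  · simp at h
  · simp [List.replicate_succ, ← List.replicate_succ']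

theorem filter_inter (p : ℕ → Bool) (x : ℕ) (n : List ℕ) (Z : List (List ℕ)) (hx : p x) :
    (inter x n Z).filter p = inter x n (Z.map (List.filter p)) := by
  induction n generalizing Z with
  | nil => simp [inter]
  | cons i n ih =>
    rcases Z with _ | ⟨z, Z⟩
    · simp [inter]
    · have := ih Z
      simp only [inter] at this ⊢
      simp [hx, this]

theorem filter_ne_inter (x : ℕ) (n : List ℕ) (Z : List (List ℕ)) (h : n.length = Z.length) :
    (inter x n Z).filter (· != x) = Z.flatten.filter (· != x) := by
  induction n generalizing Z with
  | nil =>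
    rcases Z with _ | ⟨z, Z⟩
    · simp [inter]
    · simp at h
  | cons i n ih =>
    rcases Z with _ | ⟨z, Z⟩
    · simp at h
    · have := ih Z (by simpa using h)
      simp only [inter] at this ⊢
      simp [this]

theorem inter_append_singleton (x : ℕ) (n ts : List ℕ) (s : ℕ) (h : n.length = ts.length + 1) :
    inter x n (ts.map ([·]) ++ [[]]) ++ [s] = inter x n ((ts ++ [s]).map ([·])) := by
  induction n generalizing ts with
  | nil => simp at h
  | cons i n ih =>
    rcases ts with _ | ⟨t, ts⟩
    · obtain rfl : n = [] := by simpa using h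
      simp [inter]
    · have := ih ts (by simpa using h)
      simp only [inter] at this
      simp only [inter, List.map_cons, List.cons_append, List.zipWith_cons_cons,
        List.flatten_cons, ← this, List.append_assoc]

theorem VecSat.valid_inter {N : Type*} [Monoid N] {n n' : List ℕ} (h : VecSat N n n') (x : ℕ)
    (Z : List (List ℕ)) (hZ : Z.length = n.length) : Valid N (inter x n Z) (inter x n' Z) :=
  fun f => by
    rw [prod_map_inter, prod_map_inter, h.2]
    simpa using hZ

theorem VecSat.pair_add {N : Type*} [Monoid N] {p q : ℕ} (h : VecSat N [p, q] [p + 1, q]) (k : ℕ) :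
    VecSat N [p, q] [p + k, q] := by
  induction k with
  | zero => exact .refl _
  | succ k ih =>
    refine ih.trans ⟨rfl, fun a Z hZ => ?_⟩
    have := congrArg (a ^ k * ·) (h.2 a Z hZ)
    rcases Z with _ | ⟨z, _ | ⟨z', _ | _⟩⟩ <;> simp [vecVal] at hZ this ⊢
    simp only [← mul_assoc, ← pow_add] at this ⊢
    rw [add_comm p k, this]
    congr 4
    omega


/-- For words without repetition the scattered pairs are a linear order on the variables. -/
theorem A01.eq_of_valid_of_nodup {u v : List ℕ} (h : Valid A01 u v) (hu : u.Nodup)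
    (hv : v.Nodup) : u = v := by
  rw [valid_iff] at h
  have hperm : u.Perm v := (List.perm_ext_iff_of_nodup hu hv).2 h.1
  refine List.Perm.eq_of_pairwise (le := fun a b => [a, b].Sublist u) ?_ ?_ ?_ hperm
  · intro a b ha _ h1 h2
    by_contra hab
    have := two_le_count_of_pairs hab (List.count_eq_one_of_mem hu ha) h2 h1
    have := List.nodup_iff_count_le_one.1 hu b
    omega
  · exact List.pairwise_iff_forall_sublist.2 fun {a b} h => h
  · exact List.pairwise_iff_forall_sublist.2 fun {a b} h' => (h.2 a b).2 h'

theorem exists_ends {x : ℕ} {u : List ℕ} (h : 2 ≤ u.count x) :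
    ∃ P U S, u = P ++ x :: (U ++ [x]) ++ S ∧ x ∉ P ∧ x ∉ S := by
  obtain ⟨P, q, rfl, hP⟩ :=
    List.eq_append_cons_of_mem (List.count_pos_iff.1 (by omega : 0 < u.count x))
  have hq : x ∈ q.reverse := by
    rw [List.count_append, List.count_cons_self, List.count_eq_zero_of_not_mem hP] at h
    exact List.mem_reverse.2 (List.count_pos_iff.1 (by omega))
  obtain ⟨S, U, hSU, hS⟩ := List.eq_append_cons_of_mem hq
  have : q = U.reverse ++ [x] ++ S.reverse := by
    rw [← List.reverse_reverse q, hSU]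
    simp
  exact ⟨P, U.reverse, S.reverse, by simp [this], hP, by simpa using hS⟩

theorem pair_sublist_ends {x y : ℕ} {U : List ℕ} (P S : List ℕ) (hy : y ∈ U) :
    [x, y].Sublist (P ++ x :: (U ++ [x]) ++ S) ∧ [y, x].Sublist (P ++ x :: (U ++ [x]) ++ S) := by
  have e : P ++ x :: (U ++ [x]) ++ S = (P ++ [x]) ++ (U ++ ([x] ++ S)) := by simp
  rw [e]
  exact ⟨pair_sublist_append (by simp) (by simp [hy]),
    (pair_sublist_append hy (by simp)).trans (List.sublist_append_right _ _)⟩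

theorem filter_outer_eq_nil {x : ℕ} {P U S : List ℕ} (hP : x ∉ P) (hS : x ∉ S) (p : ℕ → Bool)
    (hp : ∀ y, y ≠ x → p y → (P ++ x :: (U ++ [x]) ++ S).count y = 1 ∧
      [x, y].Sublist (P ++ x :: (U ++ [x]) ++ S) ∧ [y, x].Sublist (P ++ x :: (U ++ [x]) ++ S)) :
    P.filter p = [] ∧ S.filter p = [] := by
  constructor
  · refine List.filter_eq_nil_iff.2 fun y hy hpy => ?_
    obtain ⟨h1, h2, -⟩ := hp y (fun h => hP (h ▸ hy)) hpy
    rw [List.append_assoc] at h1 h2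
    refine not_pair_sublist hP ?_ h2
    rw [← List.count_eq_zero]
    have := List.count_pos_iff.2 hy
    rw [List.count_append] at h1
    omega
  · refine List.filter_eq_nil_iff.2 fun y hy hpy => ?_
    obtain ⟨h1, -, h2⟩ := hp y (fun h => hS (h ▸ hy)) hpy
    refine not_pair_sublist ?_ hS h2
    rw [← List.count_eq_zero]
    have := List.count_pos_iff.2 hy
    rw [List.count_append] at h1
    omega

theorem eq_replicate_of_filter_ne_eq_nil {x : ℕ} {w : List ℕ} (h : w.filter (· != x) = []) :
    w = List.replicate w.length x :=
  List.eq_replicate_length.2 fun y hy => by simpa using List.filter_eq_nil_iff.1 h y hy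

/-- Hypotheses under which all identities of `M` follow from those of `Q`. -/
structure Controls (M Q : Type*) [Monoid M] [Monoid Q] : Prop where
  sigma : SigmaLaws Q
  valid : ∀ u v, Valid Q u v → Valid M u v
  a01 : ∀ u v, Valid M u v → Valid A01 u v
  vec : ∀ n n', VecSat M n n' → VecSat Q n n'
  count : ∀ u v x, Valid M u v → 2 ≤ u.count x → u.count x = v.count x ∨
    ∃ p q, 0 < p ∧ 0 < q ∧ p + q ≤ u.count x ∧ p + q ≤ v.count x ∧ VecSat Q [p, q] [p + 1, q]

namespace Controls

variable {M Q : Type*} [Monoid M] [Monoid Q]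

theorem exists_count_split (h : Controls M Q) {u v : List ℕ} (x : ℕ) (huv : Valid M u v)
    (hu : 2 ≤ u.count x) : ∃ k k' b, u.count x = k + 1 + (b + 1) ∧ v.count x = k' + 1 + (b + 1) ∧
      VecSat Q [k + 1, b + 1] [k' + 1, b + 1] := by
  rcases h.count u v x huv hu with he | ⟨p, q, hp, hq, h1, h2, hs⟩
  · exact ⟨u.count x - 2, u.count x - 2, 0, by omega, by omega, .refl _⟩
  · refine ⟨u.count x - q - 1, v.count x - q - 1, q - 1, by omega, by omega, ?_⟩
    have e1 := hs.pair_add (u.count x - q - p)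
    have e2 := hs.pair_add (v.count x - q - p)
    have a1 : u.count x - q - 1 + 1 = p + (u.count x - q - p) := by omega
    have a2 : v.count x - q - 1 + 1 = p + (v.count x - q - p) := by omega
    have a3 : q - 1 + 1 = q := by omega
    rw [a1, a2, a3]
    exact e1.symm.trans e2

/-- Projecting to `x` and the linear variables of its span turns the identity into a vector
identity. The chunks `Z` distribute the rest of `U` over the linear variables, so that this identity
can be applied inside the full word. -/
theorem exists_vectors (h : Controls M Q) {u v P U S : List ℕ} {x : ℕ} (huv : Valid M u v)
    (hu : u = P ++ x :: (U ++ [x]) ++ S) (hP : x ∉ P) (hS : x ∉ S) (p : ℕ → Bool)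
    (hp : ∀ y, p y ↔ y = x ∨ (y ∈ U ∧ u.count y = 1)) :
    ∃ (Z : List (List ℕ)) (k b k' b' : ℕ) (mid mid' : List ℕ), Z.flatten = U.filter (· != x) ∧
      mid.length + 1 = Z.length ∧ mid'.length + 1 = Z.length ∧
      VecSat Q ((k + 1) :: mid ++ [b + 1]) ((k' + 1) :: mid' ++ [b' + 1]) ∧
      u.filter p = inter x ((k + 1) :: mid ++ [b + 1]) (Z.map (List.filter p) ++ [[]]) ∧
      v.filter p = inter x ((k' + 1) :: mid' ++ [b' + 1]) (Z.map (List.filter p) ++ [[]]) := by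
  have hA := h.a01 u v huv
  have hA' := (A01.valid_iff u v).1 hA
  have hpx : p x := (hp x).2 (Or.inl rfl)
  have hcu : 2 ≤ u.count x := by
    rw [hu]
    simp
    omega
  have hcv : 2 ≤ v.count x := by
    rw [two_le_count_iff] at hcu ⊢
    exact (hA'.2 x x).1 hcu
  have hlin : ∀ y, y ≠ x → p y → u.count y = 1 ∧ [x, y].Sublist u ∧ [y, x].Sublist u := by
    intro y hy hpy
    obtain ⟨hyU, hy1⟩ := ((hp y).1 hpy).resolve_left hy
    rw [hu]
    exact ⟨hu ▸ hy1, pair_sublist_ends P S hyU⟩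
  obtain ⟨P', U', S', hv, hP', hS'⟩ := exists_ends hcv
  have hfu : u.filter p = x :: (U.filter p ++ [x]) := by
    obtain ⟨h1, h2⟩ := filter_outer_eq_nil (U := U) hP hS p (by rwa [← hu])
    rw [hu]
    simp [h1, h2, hpx]
  have hfv : v.filter p = x :: (U'.filter p ++ [x]) := by
    obtain ⟨h1, h2⟩ := filter_outer_eq_nil (U := U') hP' hS' p (by
      rw [← hv]
      intro y hy hpy
      obtain ⟨h1, h2, h3⟩ := hlin y hy hpy
      exact ⟨A01.count_eq_one hA h1, (hA'.2 _ _).1 h2, (hA'.2 _ _).1 h3⟩)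
    rw [hv]
    simp [h1, h2, hpx]
  have hnod : ∀ w, Valid A01 u w → ((w.filter p).filter (· != x)).Nodup := by
    intro w hw
    refine List.nodup_iff_count_le_one.2 fun y => ?_
    by_cases hy : y ∈ (w.filter p).filter (· != x)
    · simp only [List.mem_filter, bne_iff_ne] at hy
      have := A01.count_eq_one hw (hlin y hy.2 hy.1.2).1
      exact (((List.filter_sublist).trans (List.filter_sublist)).count_le y).trans this.le
    · rw [List.count_eq_zero_of_not_mem hy]
      exact zero_le_one
  have hts := A01.eq_of_valid_of_nodup ((hA.filter p).filter (· != x)) (hnod u (.refl u))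
    (hnod v hA)
  have hpxn : ∀ w : List ℕ, (x :: (w ++ [x])).filter (· != x) = w.filter (· != x) := by simp
  have hnodts := hnod u (.refl u)
  rw [hfu, hpxn] at hnodts
  rw [hfu, hfv, hpxn, hpxn] at hts
  have hU : (U.filter (· != x)).filter p = (U.filter p).filter (· != x) := List.filter_comm ..
  rcases eq_or_ne ((U.filter p).filter (· != x)) [] with hnil | hne
  -- Without linear variables in the span, the projection only relates powers of `x` and says
  -- nothing about occurrences separated by repeated variables; the field `count` of `Controls`
  -- fills this gap, with all of `U` as the single chunk.
  · obtain ⟨k, k', b, h1, h2, hs⟩ := h.exists_count_split x huv hcu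
    have key : ∀ (w : List ℕ) (W : List ℕ) k, w.filter p = x :: (W.filter p ++ [x]) →
        (W.filter p).filter (· != x) = [] → w.count x = k + 1 + (b + 1) →
        w.filter p = inter x [k + 1, b + 1] [[], []] := by
      intro w W k h1 h2 h3
      have : w.filter p = List.replicate (w.filter p).length x :=
        eq_replicate_of_filter_ne_eq_nil (by rw [h1, hpxn, h2])
      have hlen : (w.filter p).length = w.count x := by
        rw [← List.count_filter hpx]
        conv_rhs => rw [this]
        simp
      rw [this, hlen, h3]
      simp [inter, List.replicate_add]
    refine ⟨[U.filter (· != x)], k, b, k', b, [], [], by simp, rfl, rfl, hs, ?_, ?_⟩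
    · simpa [hU, hnil] using key u U k hfu hnil h1
    · simpa [hU, hnil] using key v U' k' hfv (hts ▸ hnil) h2
  · set ts := (U.filter p).filter (· != x) with hts_def
    obtain ⟨Z, hZ, hZ'⟩ := exists_chunks p (U.filter (· != x)) ts hU hne
    have hlenZ : Z.length = ts.length := by simpa using congrArg List.length hZ'
    obtain ⟨l, b, hl, hw⟩ := exists_eq_inter x (U.filter p) ts rfl
    obtain ⟨l', b', hl', hw'⟩ := exists_eq_inter x (U'.filter p) ts hts.symm
    have hpos := List.length_pos_iff.2 hne
    rcases l with _ | ⟨k, mid⟩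
    · simp at hl
      omega
    rcases l' with _ | ⟨k', mid'⟩
    · simp at hl'
      omega
    simp only [List.length_cons] at hl hl'
    rw [hw] at hfu
    rw [hw'] at hfv
    have hfu' := hfu.trans (inter_ends x k b mid (ts.map ([·])) (by simpa using hl)).symm
    have hfv' := hfv.trans (inter_ends x k' b' mid' (ts.map ([·])) (by simpa using hl')).symm
    refine ⟨Z, k, b, k', b', mid, mid', hZ, by omega, by omega, ?_, by rw [hZ', hfu'],
      by rw [hZ', hfv']⟩
    apply h.vec
    -- In `VecSat` every exponent is followed by a value, so the final power of `x` gets a fresh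
    -- linear variable behind it.
    obtain ⟨s, hs⟩ := Infinite.exists_notMem_finset (x :: ts).toFinset
    simp only [List.mem_toFinset, List.mem_cons, not_or] at hs
    have hxts : x ∉ ts := by simp [hts_def]
    rw [vecSat_iff_valid x (ts ++ [s])
      (List.nodup_append.2 ⟨hnodts, by simp, by
        rintro a ha b hb rfl
        exact hs.2 (by simpa [List.mem_singleton.1 hb] using ha)⟩)
      (by simp [hxts, Ne.symm hs.1]) _ _ (by simp; omega) (by simp; omega),
      ← inter_append_singleton _ _ _ _ (by simp; omega),
      ← inter_append_singleton _ _ _ _ (by simp; omega), ← hfu', ← hfv']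
    exact (huv.filter p).append_right [s]

/-- For repeated `x`, σ₁ and σ₂ first gather the inner occurrences of `x` at the borders of the
chunks (`v1`), without crossing a linear variable; then the vector identity replaces the exponents
by those of `v` (`v2`). Only occurrences of `x` move, so agreement at other variables survives. -/
theorem exists_agree (h : Controls M Q) {u v : List ℕ} (x : ℕ) (huv : Valid M u v) :
    ∃ u', Valid Q u u' ∧ Agree u' v x ∧ ∀ y, y ≠ x → Agree u v y → Agree u' v y := by
  have hA := h.a01 u v huv
  by_cases hu : 2 ≤ u.count x
  swap
  · refine ⟨u, .refl u, ?_, fun y _ hy => hy⟩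
    refine agree_of_filter hA x (· == x) (by simp) (fun t ht h1 h2 => ?_) ?_
    · by_contra htx
      exact hu (two_le_count_of_pairs (by simpa using htx) ht h1 h2)
    · rw [List.filter_beq, List.filter_beq]
      congr 1
      by_cases hx : u.count x = 1
      · rw [hx, A01.count_eq_one hA hx]
      · have : u.count x = 0 := by omega
        rw [this, eq_comm, List.count_eq_zero, ← ((A01.valid_iff _ _).1 hA).1 x,
          ← List.count_eq_zero, this]
  obtain ⟨P, U, S, hu', hP, hS⟩ := exists_ends hu
  set p : ℕ → Bool := fun y => decide (y = x ∨ (y ∈ U ∧ u.count y = 1)) with hp_def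
  have hp : ∀ y, p y ↔ y = x ∨ (y ∈ U ∧ u.count y = 1) := fun y => by simp [hp_def]
  have hpx : p x := (hp x).2 (Or.inl rfl)
  obtain ⟨Z, k, b, k', b', mid, mid', hZ, hm, hm', hs, hfu, hfv⟩ :=
    h.exists_vectors huv hu' hP hS p hp
  have hout : P.filter p = [] ∧ S.filter p = [] := by
    refine filter_outer_eq_nil (U := U) hP hS p fun y hy hpy => ?_
    obtain ⟨hyU, hy1⟩ := ((hp y).1 hpy).resolve_left hy
    exact ⟨hu' ▸ hy1, pair_sublist_ends P S hyU⟩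
  set G := inter x (k :: mid) Z ++ List.replicate b x with hG
  set G' := inter x (k' :: mid') Z ++ List.replicate b' x with hG'
  have e1 : inter x ((k + 1) :: mid ++ [b + 1]) (Z ++ [[]]) = x :: (G ++ [x]) :=
    inter_ends x k b mid Z hm
  have e2 : inter x ((k' + 1) :: mid' ++ [b' + 1]) (Z ++ [[]]) = x :: (G' ++ [x]) :=
    inter_ends x k' b' mid' Z hm'
  have f1 : (P ++ x :: (G ++ [x]) ++ S).filter p = u.filter p := by
    rw [← e1, List.filter_append, List.filter_append, hout.1, hout.2, filter_inter _ _ _ _ hpx, hfu]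
    simp
  have f2 : (P ++ x :: (G' ++ [x]) ++ S).filter p = v.filter p := by
    rw [← e2, List.filter_append, List.filter_append, hout.1, hout.2, filter_inter _ _ _ _ hpx, hfv]
    simp
  have g1 : G.filter (· != x) = U.filter (· != x) := by
    rw [hG, List.filter_append, filter_ne_inter _ _ _ (by simpa using hm), hZ]
    simp
  have g2 : G'.filter (· != x) = U.filter (· != x) := by
    rw [hG', List.filter_append, filter_ne_inter _ _ _ (by simpa using hm'), hZ]
    simp
  have v1 : Valid Q u (P ++ x :: (G ++ [x]) ++ S) := by
    have := h.sigma.valid_of_filter_ne P S g1.symm p hpx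
      (fun t ht h1 => (hp t).2 (Or.inr ⟨ht, by rwa [hu']⟩)) (by rw [← hu', f1]) hP hS
    rwa [← hu'] at this
  have v2 : Valid Q (P ++ x :: (G ++ [x]) ++ S) (P ++ x :: (G' ++ [x]) ++ S) := by
    rw [← e1, ← e2]
    exact ((hs.valid_inter x _ (by simp [hm])).append_left P).append_right S
  have v3 := v1.trans v2
  have hA3 := h.a01 _ _ (h.valid _ _ v3)
  have hA4 := hA3.symm.trans hA
  refine ⟨_, v3, agree_of_filter hA4 x p hpx (fun t ht h1 h2 => ?_) f2, fun y hy hag => ?_⟩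
  · have ht' := A01.count_eq_one hA3.symm ht
    refine (hp t).2 (Or.inr ⟨?_, ht'⟩)
    have h1' := (((A01.valid_iff _ _).1 hA3).2 _ _).2 h1
    have h2' := (((A01.valid_iff _ _).1 hA3).2 _ _).2 h2
    have htx : t ≠ x := by
      rintro rfl
      omega
    have h3 := (((A01.valid_iff _ _).1 hA3).1 t).2 (h1.subset (by simp))
    by_contra htU
    rw [hu'] at h1' h2' h3 ht'
    simp only [List.mem_append, List.mem_cons, htx, htU, List.not_mem_nil, or_false]
      at h3
    rcases h3 with h3 | h3
    · rw [List.append_assoc] at h1' ht'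
      refine not_pair_sublist hP ?_ h1'
      rw [← List.count_eq_zero]
      have := List.count_pos_iff.2 h3
      rw [List.count_append] at ht'
      omega
    · refine not_pair_sublist ?_ hS h2'
      rw [← List.count_eq_zero]
      have := List.count_pos_iff.2 h3
      rw [List.count_append] at ht'
      omega
  · refine hag.of_filter_ne hy ?_ ?_
    · simp
      omega
    · rw [hu']
      simp only [List.filter_append, List.filter_cons, g2]

/-- The variables of `u` are adjusted one after the other. Each step is valid in `Q`, hence in `M`,
so the modified word still forms an identity of `M` with `v`. -/
theorem valid_of_valid (h : Controls M Q) {u v : List ℕ} (huv : Valid M u v) : Valid Q u v := by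
  have step : ∀ l : List ℕ, ∃ u', Valid Q u u' ∧ ∀ x ∈ l, Agree u' v x := by
    intro l
    induction l with
    | nil => exact ⟨u, .refl u, by simp⟩
    | cons x l ih =>
      obtain ⟨u₁, h1, h2⟩ := ih
      obtain ⟨u₂, h3, h4, h5⟩ := h.exists_agree x ((h.valid _ _ h1).symm.trans huv)
      refine ⟨u₂, h1.trans h3, fun y hy => ?_⟩
      by_cases hyx : y = x
      · exact hyx ▸ h4
      · exact h5 y hyx (h2 y ((List.mem_cons.1 hy).resolve_left hyx))
  obtain ⟨u', h1, h2⟩ := step u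
  have hA := h.a01 _ _ ((h.valid _ _ h1).symm.trans huv)
  have hA' := (A01.valid_iff _ _).1 hA
  have hag : ∀ x, Agree u' v x := by
    intro x
    by_cases hx : x ∈ u
    · exact h2 x hx
    · have hx1 : x ∉ v := fun hv =>
        hx ((((A01.valid_iff _ _).1 (h.a01 _ _ huv)).1 x).2 hv)
      have hx2 : x ∉ u' := fun hv => hx1 ((hA'.1 x).1 hv)
      refine ⟨by rw [List.count_eq_zero_of_not_mem hx1, List.count_eq_zero_of_not_mem hx2],
        fun t _ => ?_⟩
      rw [List.count_eq_zero_of_not_mem, List.count_eq_zero_of_not_mem]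
      · exact fun h => hx1 ((List.takeWhile_prefix _).subset h)
      · exact fun h => hx2 ((List.takeWhile_prefix _).subset h)
  exact h1.trans (h.sigma.valid_of_sameShape
    ⟨fun x => (hag x).1, hA'.2, fun t ht x => (hag x).2 t ht⟩)

end Controls


/-! ## A criterion for the finite basis property of monoids -/

/-- The list of letters of a nonempty word. -/
def letters (U : Word) : List ℕ := U.head :: U.tail

theorem lift_eq_prod {N : Type*} [Monoid N] (f : ℕ → N) (U : Word) :
    FreeSemigroup.lift f U = ((letters U).map f).prod := by
  induction U using FreeSemigroup.recOnMul with
  | ih1 x => rw [FreeSemigroup.lift_of]; simp [letters, FreeSemigroup.of]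
  | ih2 x y hx hy =>
    rw [map_mul, hx, hy]
    simp [letters, FreeSemigroup.of]

theorem satisfies_iff_valid {N : Type*} [Monoid N] (e : Identity) :
    Satisfies N e ↔ Valid N (letters e.1) (letters e.2) := by
  simp only [Satisfies, Valid, lift_eq_prod]

theorem exists_letters_eq {u : List ℕ} (hu : u ≠ []) : ∃ U : Word, letters U = u := by
  rcases u with _ | ⟨a, u⟩
  · exact absurd rfl hu
  · exact ⟨⟨a, u⟩, rfl⟩

theorem letters_injective : Function.Injective letters := by
  rintro ⟨a, u⟩ ⟨b, v⟩ h
  simp only [letters, List.cons.injEq] at h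
  rw [h.1, h.2]

/-- The length of the word and the indices of its variables are bounded by `K`. -/
def IsSmall (K : ℕ) (u : List ℕ) : Prop := u.length ≤ K ∧ ∀ x ∈ u, x ≤ K

theorem IsSmall.filter {K : ℕ} {u : List ℕ} (h : IsSmall K u) (p : ℕ → Bool) :
    IsSmall K (u.filter p) :=
  ⟨(List.length_filter_le _ _).trans h.1, fun x hx => h.2 x (List.mem_of_mem_filter hx)⟩

theorem isSmall_of_le {K : ℕ} {u : List ℕ} (h : u.length + u.sum ≤ K) : IsSmall K u :=
  ⟨by omega, fun x hx => by
    have := List.le_sum_of_mem hx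
    omega⟩

theorem finite_isSmall (K : ℕ) : {u | IsSmall K u}.Finite := by
  refine ((List.finite_length_le (Fin (K + 1)) K).image (List.map Fin.val)).subset ?_
  rintro u ⟨h1, h2⟩
  refine ⟨u.map (Fin.ofNat (K + 1)), by simpa using h1, ?_⟩
  rw [List.map_map]
  conv_rhs => rw [← List.map_id u]
  refine List.map_congr_left fun x hx => ?_
  have := h2 x hx
  simp only [Function.comp_apply, Fin.val_ofNat, id]
  exact Nat.mod_eq_of_lt (by omega)

/-- The fully invariant congruence of all identities derivable from `B`. -/
def derivesCon (B : Set Identity) : Con Word where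
  r := Derives B
  iseqv := ⟨Derives.refl, Derives.symm, Derives.trans⟩
  mul' := Derives.mul

theorem prod_map_coe_mk (B : Set Identity) (φ : ℕ → Word) (U : Word) :
    ((letters U).map fun i => (((φ i : (derivesCon B).Quotient)) : WithOne (derivesCon B).Quotient)).prod
      = ((FreeSemigroup.lift φ U : (derivesCon B).Quotient) : WithOne (derivesCon B).Quotient) := by
  rw [← lift_eq_prod]
  induction U using FreeSemigroup.recOnMul with
  | ih1 x => simp
  | ih2 x y hx hy => rw [map_mul, map_mul, hx, hy]; rfl

/-- The test monoid is the free semigroup modulo the consequences of the small identities, with 1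
adjoined. Variables sent to 1 are deleted, which keeps identities small; by `hnil` one side cannot
become empty without the other. -/
theorem isFinitelyBased_of_small {M : Type*} [Monoid M] (hnil : ∀ v, Valid M [] v → v = []) (K : ℕ)
    (h : ∀ (Q : Type) [Monoid Q],
      (∀ u v, Valid M u v → IsSmall K u → IsSmall K v → Valid Q u v) →
        ∀ u v, Valid M u v → Valid Q u v) : IsFinitelyBased M := by
  classical
  set B : Set Identity := {e | Satisfies M e ∧ IsSmall K (letters e.1) ∧ IsSmall K (letters e.2)}
    with hB
  refine ⟨B, fun e he => he.1, ?_, ?_⟩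
  · refine Set.Finite.subset (s := {U : Word | IsSmall K (letters U)} ×ˢ
      {U : Word | IsSmall K (letters U)}) ?_ fun e he => ⟨he.2.1, he.2.2⟩
    have := (finite_isSmall K).preimage (f := letters) letters_injective.injOn
    exact this.prod this
  · have hQ := h (WithOne (derivesCon B).Quotient) fun u v huv hu hv f => by
      have hfil : ∀ w : List ℕ, (w.map f).prod = ((w.filter fun i => decide (f i ≠ 1)).map f).prod := by
        intro w
        induction w with
        | nil => rfl
        | cons a w ih => by_cases ha : f a = 1 <;> simp [ha, ih]
      have huv' := huv.filter fun i => decide (f i ≠ 1)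
      rw [hfil u, hfil v]
      set u' := u.filter fun i => decide (f i ≠ 1) with hu'
      set v' := v.filter fun i => decide (f i ≠ 1) with hv'
      by_cases hu0 : u' = []
      · rw [hu0] at huv' ⊢
        rw [hnil _ huv']
      by_cases hv0 : v' = []
      · rw [hv0] at huv'
        exact absurd (hnil _ huv'.symm) hu0
      obtain ⟨U, hU⟩ := exists_letters_eq hu0
      obtain ⟨V, hV⟩ := exists_letters_eq hv0
      have hUV : (U, V) ∈ B := ⟨by rw [satisfies_iff_valid, hU, hV]; exact huv',
        by rw [hU]; exact hu.filter _, by rw [hV]; exact hv.filter _⟩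
      have hφ : ∀ i, ∃ w : Word, f i ≠ 1 →
          f i = ((w : (derivesCon B).Quotient) : WithOne (derivesCon B).Quotient) := by
        intro i
        by_cases hi : f i = 1
        · exact ⟨var 0, fun h => absurd hi h⟩
        · obtain ⟨q, hq⟩ := WithOne.ne_one_iff_exists.1 hi
          obtain ⟨w, rfl⟩ := Quotient.exists_rep q
          exact ⟨w, fun _ => hq.symm⟩
      choose φ hφ using hφ
      have hmap : ∀ w : List ℕ, (w.filter fun i => decide (f i ≠ 1)).map f =
          (w.filter fun i => decide (f i ≠ 1)).map fun i =>
            (((φ i : (derivesCon B).Quotient)) : WithOne (derivesCon B).Quotient) := fun w =>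
        List.map_congr_left fun i hi => hφ i (by simpa using List.of_mem_filter hi)
      rw [hu', hv', hmap, hmap, ← hu', ← hv', ← hU, ← hV, prod_map_coe_mk, prod_map_coe_mk]
      congr 1
      exact (Con.eq _).2 (Derives.subst φ (Derives.ax hUV))
    rintro ⟨U, V⟩ hUV
    have h1 := hQ _ _ ((satisfies_iff_valid _).1 hUV)
      fun i => (((var i : Word) : (derivesCon B).Quotient) : WithOne (derivesCon B).Quotient)
    rw [prod_map_coe_mk, prod_map_coe_mk, WithOne.coe_inj] at h1
    have hid : ∀ W : Word, FreeSemigroup.lift var W = W := by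
      intro W
      induction W using FreeSemigroup.recOnMul with
      | ih1 x => simp [var]
      | ih2 x y hx hy => rw [map_mul, hx, hy]
    rw [hid, hid] at h1
    exact (Con.eq _).1 h1

theorem sigmaLaws_iff {N : Type*} [Monoid N] : SigmaLaws N ↔
    Valid N [0, 1, 2, 0, 3, 1] [1, 0, 2, 0, 3, 1] ∧ Valid N [0, 2, 1, 3, 0, 1] [0, 2, 1, 3, 1, 0] := by
  constructor
  · intro h
    refine ⟨fun f => ?_, fun f => ?_⟩
    · simpa [mul_assoc] using h.left (f 0) (f 1) (f 2) (f 3)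
    · simpa [mul_assoc] using h.right (f 0) (f 1) (f 2) (f 3)
  · rintro ⟨h1, h2⟩
    refine ⟨fun x y s t => ?_, fun x y s t => ?_⟩
    · simpa [mul_assoc] using h1 fun i => if i = 0 then x else if i = 1 then y else
        if i = 2 then s else t
    · simpa [mul_assoc] using h2 fun i => if i = 0 then x else if i = 1 then y else
        if i = 2 then s else t

theorem Valid.prod {N P : Type*} [Monoid N] [Monoid P] {u v : List ℕ} :
    Valid (N × P) u v ↔ Valid N u v ∧ Valid P u v := by
  have key : ∀ (f : ℕ → N × P) (w : List ℕ),
      (w.map f).prod = ((w.map fun i => (f i).1).prod, (w.map fun i => (f i).2).prod) := by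
    intro f w
    induction w with
    | nil => rfl
    | cons a w ih => rw [List.map_cons, List.prod_cons, ih]; rfl
  constructor
  · intro h
    refine ⟨fun f => ?_, fun f => ?_⟩
    · have := h fun i => (f i, 1)
      rw [key, key] at this
      exact congrArg Prod.fst this
    · have := h fun i => (1, f i)
      rw [key, key] at this
      exact congrArg Prod.snd this
  · rintro ⟨h1, h2⟩ f
    rw [key, key, h1, h2]

/-- A monoid that satisfies `σ₁`, `σ₂` and only identities of `A₀¹` is finitely based, if each of
its identities that is not balanced at `x` allows to multiply `x` between its first and last
occurrences. -/
theorem isFinitelyBased_of_count {M : Type*} [Monoid M] (hσ : SigmaLaws M)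
    (hA : ∀ u v, Valid M u v → Valid A01 u v)
    (hcount : ∀ u v x, Valid M u v → 2 ≤ u.count x → u.count x = v.count x ∨
      ∃ p q, 0 < p ∧ 0 < q ∧ p + q ≤ u.count x ∧ p + q ≤ v.count x ∧
        VecSat M [p, q] [p + 1, q]) : IsFinitelyBased M := by
  obtain ⟨F, hF, hFQ⟩ := exists_finset_vecSat M
  set E : List ℕ → ℕ → List ℕ := fun n k => inter 0 n ((List.range' 1 k).map ([·])) with hE
  set size : List ℕ → ℕ := fun u => u.length + u.sum with hsize
  -- Length plus index sum is 13 for each side of σ₁ and σ₂; the sum covers the basic vector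
  -- identities, spelled with `0` for the repeated variable and `1, 2, …` for the linear ones.
  set K := 20 + ∑ g ∈ F, (size (E g.1 g.1.length) + size (E g.2 g.1.length)) with hK
  refine isFinitelyBased_of_small (fun v hv => ?_) K fun Q _ hQ u v huv => ?_
  · have := ((A01.valid_iff _ _).1 (hA _ _ hv)).1
    exact List.eq_nil_iff_forall_not_mem.2 fun x hx => by simpa using (this x).2 hx
  · have hσQ : SigmaLaws Q := by
      have := sigmaLaws_iff.1 hσ
      refine sigmaLaws_iff.2 ⟨hQ _ _ this.1 ?_ ?_, hQ _ _ this.2 ?_ ?_⟩ <;>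
      exact isSmall_of_le (by simp [hK]; omega)
    have hvec : ∀ n n', VecSat M n n' → VecSat Q n n' := hFQ Q fun g hg => by
      have hsat := hF g hg
      have hle : size (E g.1 g.1.length) + size (E g.2 g.1.length) ≤ K := by
        have := Finset.single_le_sum (f := fun g : List ℕ × List ℕ =>
          size (E g.1 g.1.length) + size (E g.2 g.1.length)) (fun _ _ => Nat.zero_le _) hg
        omega
      have hnod : (List.range' 1 g.1.length).Nodup := List.nodup_range'
      have h0 : 0 ∉ List.range' 1 g.1.length := by
        simp only [List.mem_range'_1]
        omega
      have hlen : g.2.length = (List.range' 1 g.1.length).length := by simp [hsat.1]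
      rw [vecSat_iff_valid 0 _ hnod h0 _ _ (by simp) hlen] at hsat ⊢
      exact hQ _ _ hsat (isSmall_of_le (by simp only [hsize, hE] at hle ⊢; omega))
        (isSmall_of_le (by simp only [hsize, hE] at hle ⊢; omega))
    -- The extra factor `M` guarantees that whatever holds in the controlling monoid holds in `M`.
    have hctrl : Controls M (Q × M) :=
      { sigma := sigmaLaws_iff.2
          ⟨Valid.prod.2 ⟨(sigmaLaws_iff.1 hσQ).1, (sigmaLaws_iff.1 hσ).1⟩,
            Valid.prod.2 ⟨(sigmaLaws_iff.1 hσQ).2, (sigmaLaws_iff.1 hσ).2⟩⟩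
        valid := fun u v h => (Valid.prod.1 h).2
        a01 := hA
        vec := fun n n' h => (hvec n n' h).prod h
        count := fun u v x h h2 => by
          rcases hcount u v x h h2 with h | ⟨p, q, hp, hq, h3, h4, hs⟩
          · exact Or.inl h
          · exact Or.inr ⟨p, q, hp, hq, h3, h4, (hvec _ _ hs).prod hs⟩ }
    exact (Valid.prod.1 (hctrl.valid_of_valid huv)).1


/-! ## Identities of the monoids `S(W)` -/

section SMon

variable {α : Type*} {W : Set (FreeMonoid α)}

/-- The list of letters `l` is a subword of some word in `W`. -/
def Occurs (W : Set (FreeMonoid α)) (l : List α) : Prop := IsSubwordOf W (FreeMonoid.ofList l)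

theorem Occurs.of_append {p u q : List α} (h : Occurs W (p ++ u ++ q)) : Occurs W u :=
  IsSubwordOf.of_mul (p := FreeMonoid.ofList p) (q := FreeMonoid.ofList q) h

theorem Occurs.of_infix {u v : List α} (h : Occurs W v) (huv : u <:+: v) : Occurs W u := by
  obtain ⟨p, q, rfl⟩ := huv
  exact h.of_append

theorem prod_map_ofList (f : ℕ → List α) (u : List ℕ) :
    (u.map fun i => ((FreeMonoid.ofList (f i) : FreeMonoid α) : SMon W)).prod =
      ((FreeMonoid.ofList (u.flatMap f) : FreeMonoid α) : SMon W) := by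
  induction u with
  | nil => rfl
  | cons a u ih => rw [List.map_cons, List.prod_cons, ih, List.flatMap_cons]; rfl

theorem valid_sMon_iff {u v : List ℕ} : Valid (SMon W) u v ↔ ∀ f : ℕ → List α,
    u.flatMap f = v.flatMap f ∨ (¬ Occurs W (u.flatMap f) ∧ ¬ Occurs W (v.flatMap f)) := by
  constructor
  · intro h f
    have := h fun i => ((FreeMonoid.ofList (f i) : FreeMonoid α) : SMon W)
    rw [prod_map_ofList, prod_map_ofList] at this
    exact (Con.eq (reesCon W)).1 this
  · intro h f
    have : ∀ i, ∃ l : List α, f i = ((FreeMonoid.ofList l : FreeMonoid α) : SMon W) := fun i => by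
      obtain ⟨w, hw⟩ := Quotient.exists_rep (f i)
      exact ⟨FreeMonoid.toList w, hw.symm⟩
    choose g hg using this
    obtain rfl : f = fun i => ((FreeMonoid.ofList (g i) : FreeMonoid α) : SMon W) := funext hg
    rw [prod_map_ofList, prod_map_ofList]
    exact (Con.eq (reesCon W)).2 (h g)

/-- Under this substitution the sides of σ₁ become distinct words, so both must be zero in S(W); the
primed version below reads off the other side. -/
theorem SigmaLaws.not_occurs (hσ : SigmaLaws (SMon W)) {a b : α} (hab : a ≠ b)
    (T T' : List α) : ¬ Occurs W (a :: b :: (T ++ a :: (T' ++ [b]))) := by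
  have := valid_sMon_iff.1 (sigmaLaws_iff.1 hσ).1 fun i =>
    if i = 0 then [a] else if i = 1 then [b] else if i = 2 then T else T'
  simp [hab] at this
  exact this.1

theorem SigmaLaws.not_occurs' (hσ : SigmaLaws (SMon W)) {a b : α} (hab : a ≠ b)
    (T T' : List α) : ¬ Occurs W (a :: b :: (T ++ b :: (T' ++ [a]))) := by
  have := valid_sMon_iff.1 (sigmaLaws_iff.1 hσ).1 fun i =>
    if i = 0 then [b] else if i = 1 then [a] else if i = 2 then T else T'
  simp [hab.symm] at this
  exact this.2

theorem exists_adjacent_ne (X : List α) : (∃ a, X = List.replicate X.length a) ∨ X = [] ∨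
    ∃ A a b B, a ≠ b ∧ X = A ++ a :: b :: B := by
  induction X with
  | nil => exact Or.inr (Or.inl rfl)
  | cons c X ih =>
    rcases ih with ⟨a, ha⟩ | rfl | ⟨A, a, b, B, hab, rfl⟩
    · rcases X with _ | ⟨d, X⟩
      · exact Or.inl ⟨c, rfl⟩
      · by_cases hcd : c = d
        · subst hcd
          rw [List.length_cons, List.replicate_succ, List.cons.injEq] at ha
          obtain ⟨rfl, ha⟩ := ha
          refine Or.inl ⟨c, ?_⟩
          rw [List.length_cons, List.length_cons, List.replicate_succ, List.replicate_succ, ← ha]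
        · exact Or.inr (Or.inr ⟨[], c, d, X, hcd, rfl⟩)
    · exact Or.inl ⟨c, rfl⟩
    · exact Or.inr (Or.inr ⟨c :: A, a, b, B, hab, rfl⟩)

/-- Only powers of letters occur twice in the same word. -/
theorem SigmaLaws.eq_replicate (hσ : SigmaLaws (SMon W)) {X T : List α} (hX : X ≠ [])
    (h : Occurs W (X ++ T ++ X)) : ∃ a, X = List.replicate X.length a := by
  rcases exists_adjacent_ne X with h1 | h1 | ⟨A, a, b, B, hab, h1⟩
  · exact h1
  · exact absurd h1 hX
  · refine absurd ?_ (hσ.not_occurs hab (B ++ T ++ A) [])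
    subst h1
    exact h.of_infix ⟨A, B, by simp⟩

theorem of_pow_eq (a : α) (n : ℕ) :
    FreeMonoid.of a ^ n = FreeMonoid.ofList (List.replicate n a) := by
  induction n with
  | zero => rfl
  | succ n ih => rw [pow_succ', ih, List.replicate_succ]; rfl

theorem le_maxExponent_iff {k : ℕ} (hk : 0 < k) :
    (k : ℕ∞) ≤ maxExponent W ↔ ∃ a : α, Occurs W (List.replicate k a) := by
  constructor
  · intro h
    obtain ⟨k, rfl⟩ : ∃ j, k = j + 1 := ⟨k - 1, by omega⟩
    -- A supremum exceeding `k` forces an actual exponent of at least `k + 1`, also when the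
    -- supremum is infinite.
    have h1 : (k : ℕ∞) < maxExponent W := lt_of_lt_of_le (by exact_mod_cast Nat.lt_succ_self k) h
    simp only [maxExponent, lt_iSup_iff] at h1
    obtain ⟨j, ⟨a, ha⟩, hj⟩ := h1
    have hj' : k + 1 ≤ j := by exact_mod_cast hj
    refine ⟨a, Occurs.of_infix (v := List.replicate j a) (by rwa [of_pow_eq] at ha)
      ⟨[], List.replicate (j - (k + 1)) a, ?_⟩⟩
    rw [List.nil_append, ← List.replicate_add]
    congr 1
    omega
  · rintro ⟨a, ha⟩
    exact le_iSup₂_of_le k ⟨a, by rw [of_pow_eq]; exact ha⟩ le_rfl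

theorem flatMap_single (x : ℕ) (l : List α) (u : List ℕ) :
    (u.flatMap fun i => if i = x then l else []) = (List.replicate (u.count x) l).flatten := by
  induction u with
  | nil => simp
  | cons a u ih =>
    by_cases hax : a = x
    · simp [hax, ih, List.replicate_succ]
    · simp [hax, ih]

/-- Send `x` to a letter and all other variables to the empty word: a power that occurs in W must be
preserved. -/
theorem count_eq_or_lt {u v : List ℕ} {x : ℕ} (h : Valid (SMon W) u v) (hu : 0 < u.count x)
    (hv : 0 < v.count x) : u.count x = v.count x ∨
      (maxExponent W < u.count x ∧ maxExponent W < v.count x) := by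
  have key : ∀ {u v : List ℕ}, Valid (SMon W) u v → 0 < u.count x →
      u.count x = v.count x ∨ maxExponent W < u.count x := by
    intro u v h hu
    rw [or_iff_not_imp_right, not_lt, le_maxExponent_iff hu]
    rintro ⟨a, ha⟩
    have := valid_sMon_iff.1 h fun i => if i = x then [a] else []
    simp only [flatMap_single] at this
    have hrep : ∀ n, (List.replicate n [a]).flatten = List.replicate n a := by simp
    rw [hrep, hrep] at this
    rcases this with h1 | h1
    · simpa using congrArg List.length h1
    · exact absurd ha h1.1
  rcases key h hu with h1 | h1
  · exact Or.inl h1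
  · rcases key h.symm hv with h2 | h2
    · exact Or.inl h2.symm
    · exact Or.inr ⟨h1, h2⟩

theorem maxExponent_pos (hW : ∃ w ∈ W, w ≠ 1) : 0 < maxExponent W := by
  obtain ⟨w, hw, hw1⟩ := hW
  have : (1 : ℕ∞) ≤ maxExponent W := by
    rw [← Nat.cast_one, le_maxExponent_iff Nat.one_pos]
    induction w using FreeMonoid.casesOn with
    | one => exact absurd rfl hw1
    | of_mul a w => exact ⟨a, _, hw, 1, w, rfl⟩
  exact lt_of_lt_of_le one_pos this

/-- Since `X` occurs twice, it is a power of a letter `a`. Splitting off `a ^ p` on the left and `a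
^ q` on the right leaves a middle part: if empty, the power of `a` is too long; otherwise `h`
applies. -/
theorem not_occurs_pow_mul_pow (hσ : SigmaLaws (SMon W)) {p q : ℕ} (hp : 0 < p) (hq : 0 < q)
    (hmax : maxExponent W < (p + q : ℕ))
    (h : ∀ (b : α) (T : List α), T ≠ [] →
      ¬ Occurs W (List.replicate p b ++ T ++ List.replicate q b))
    {X : List α} (hX : X ≠ []) (T : List α) :
    ¬ Occurs W ((List.replicate p X).flatten ++ T ++ (List.replicate q X).flatten) := by
  intro hocc
  obtain ⟨p', rfl⟩ : ∃ j, p = j + 1 := ⟨p - 1, by omega⟩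
  obtain ⟨q', rfl⟩ : ∃ j, q = j + 1 := ⟨q - 1, by omega⟩
  have h1 : Occurs W (X ++ T ++ X) := hocc.of_infix
    ⟨(List.replicate p' X).flatten, (List.replicate q' X).flatten, by
      rw [List.replicate_succ' (n := p'), List.replicate_succ (n := q')]
      simp⟩
  obtain ⟨a, ha⟩ := hσ.eq_replicate hX h1
  obtain ⟨k, hk⟩ : ∃ k, X.length = k + 1 := ⟨X.length - 1, by
    have := List.length_pos_iff.2 hX
    omega⟩
  rw [hk] at ha
  subst ha
  have hfl : ∀ n, (List.replicate n (List.replicate (k + 1) a)).flatten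
      = List.replicate (n * (k + 1)) a := by simp
  rw [hfl, hfl] at hocc
  have h2 : Occurs W (List.replicate (p' + 1) a ++
      (List.replicate ((p' + 1) * k) a ++ T ++ List.replicate ((q' + 1) * k) a) ++
      List.replicate (q' + 1) a) := by
    have e1 : (p' + 1) * (k + 1) = (p' + 1) + (p' + 1) * k := by ring
    have e2 : (q' + 1) * (k + 1) = (q' + 1) * k + (q' + 1) := by ring
    have e3 : List.replicate ((p' + 1) + (p' + 1) * k) a =
      List.replicate (p' + 1) a ++ List.replicate ((p' + 1) * k) a := List.replicate_add ..
    have e4 : List.replicate ((q' + 1) * k + (q' + 1)) a =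
      List.replicate ((q' + 1) * k) a ++ List.replicate (q' + 1) a := List.replicate_add ..
    rw [e1, e2, e3, e4] at hocc
    simpa only [List.append_assoc] using hocc
  rcases eq_or_ne (List.replicate ((p' + 1) * k) a ++ T ++ List.replicate ((q' + 1) * k) a) []
    with h3 | h3
  · rw [h3, List.append_nil, ← List.replicate_add] at h2
    exact absurd ((le_maxExponent_iff (by omega)).2 ⟨a, h2⟩) (not_le.2 hmax)
  · exact h a _ h3 h2

theorem isFinitelyBased_of_condition (hσ : SigmaLaws (SMon W))
    (h : maxExponent W = ⊤ ∨ ∃ m : ℕ, maxExponent W = m ∧ ∃ d : ℕ, 0 < d ∧ d < m + 1 ∧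
      ∀ (b : α) (T : List α), T ≠ [] →
        ¬ Occurs W (List.replicate (m + 1 - d) b ++ T ++ List.replicate d b)) :
    IsFinitelyBased (A01 × SMon W) := by
  have hσ' : SigmaLaws (A01 × SMon W) := sigmaLaws_iff.2
    ⟨Valid.prod.2 ⟨(sigmaLaws_iff.1 A01.sigmaLaws).1, (sigmaLaws_iff.1 hσ).1⟩,
      Valid.prod.2 ⟨(sigmaLaws_iff.1 A01.sigmaLaws).2, (sigmaLaws_iff.1 hσ).2⟩⟩
  refine isFinitelyBased_of_count hσ' (fun u v huv => (Valid.prod.1 huv).1) fun u v x huv hu => ?_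
  obtain ⟨hA, hS⟩ := Valid.prod.1 huv
  have hv : 0 < v.count x := by
    rw [List.count_pos_iff, ← ((A01.valid_iff _ _).1 hA).1, ← List.count_pos_iff]
    omega
  rcases count_eq_or_lt hS (by omega) hv with heq | ⟨h1, h2⟩
  · exact Or.inl heq
  rcases h with htop | ⟨m, hm, d, hd, hdm, hT⟩
  · rw [htop] at h1
    exact absurd h1 (not_lt.2 le_top)
  rw [hm] at h1 h2
  have h1' : m < u.count x := by exact_mod_cast h1
  have h2' : m < v.count x := by exact_mod_cast h2
  refine Or.inr ⟨m + 1 - d, d, by omega, hd, by omega, by omega, ?_⟩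
  rw [vecSat_iff_valid 0 [1, 2] (by simp) (by simp) [m + 1 - d, d] [m + 1 - d + 1, d] rfl rfl]
  have e : ∀ n, inter 0 [n, d] ([1, 2].map ([·])) =
      List.replicate n 0 ++ [1] ++ (List.replicate d 0 ++ [2]) := by simp [inter]
  rw [e, e]
  rw [← List.append_assoc, ← List.append_assoc]
  refine (Valid.prod.2 ⟨?_, ?_⟩).append_right [2]
  · rw [A01.valid_iff]
    obtain ⟨p, hp⟩ : ∃ p, m + 1 - d = p + 1 := ⟨m - d, by omega⟩
    obtain ⟨q, rfl⟩ : ∃ q, d = q + 1 := ⟨d - 1, by omega⟩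
    rw [hp]
    have hrep : ∀ k, Valid A01 (List.replicate (k + 1) 0 ++ [1] ++ List.replicate (q + 1) 0)
        ([0] ++ [1] ++ [0]) := by
      intro k
      have h0 := A01.valid_filter_ne 0 (List.replicate k 0 ++ [1] ++ List.replicate q 0)
      have e1 : List.replicate (k + 1) 0 ++ [1] ++ List.replicate (q + 1) 0 =
          0 :: (List.replicate k 0 ++ [1] ++ List.replicate q 0 ++ [0]) := by
        rw [List.replicate_succ, List.replicate_succ']
        simp
      rw [e1]
      simpa using h0
    exact (A01.valid_iff _ _).1 ((hrep p).trans (hrep (p + 1)).symm)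
  · refine valid_sMon_iff.2 fun f => ?_
    by_cases hX : f 0 = []
    · left
      simp [hX, List.flatMap_replicate]
    · right
      have hno := not_occurs_pow_mul_pow hσ (p := m + 1 - d) (q := d) (by omega) hd
        (by rw [hm]; exact_mod_cast (by omega)) hT hX (f 1)
      have e2 : ∀ n, (List.replicate n 0 ++ [1] ++ List.replicate d 0).flatMap f =
          (List.replicate n (f 0)).flatten ++ f 1 ++ (List.replicate d (f 0)).flatten := by
        intro n
        simp [List.flatMap_replicate]
      rw [e2, e2]
      refine ⟨hno, fun h => hno (h.of_infix ⟨f 0, [], ?_⟩)⟩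
      rw [List.replicate_succ]
      simp

end SMon


/-! ## Nonfinitely based products -/

theorem letters_mul (U V : Word) : letters (U * V) = letters U ++ letters V := rfl

theorem letters_lift (f : ℕ → Word) (U : Word) :
    letters (FreeSemigroup.lift f U) = (letters U).flatMap (letters ∘ f) := by
  induction U using FreeSemigroup.recOnMul with
  | ih1 x => rw [FreeSemigroup.lift_of]; simp [letters, FreeSemigroup.of]
  | ih2 x y hx hy => rw [map_mul, letters_mul, hx, hy, letters_mul, List.flatMap_append]

/-- A property of words preserved by all one-step applications of identities from `B` is preserved
by all identities derivable from `B`. -/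
theorem Derives.preserves {B : Set Identity} (I : List ℕ → Prop)
    (hI : ∀ e ∈ B, ∀ (φ : ℕ → List ℕ) (p q : List ℕ),
      I (p ++ (letters e.1).flatMap φ ++ q) ↔ I (p ++ (letters e.2).flatMap φ ++ q))
    {U V : Word} (h : Derives B U V) : ∀ (φ : ℕ → List ℕ) (p q : List ℕ),
      I (p ++ (letters U).flatMap φ ++ q) ↔ I (p ++ (letters V).flatMap φ ++ q) := by
  induction h with
  | ax h => exact hI _ h
  | refl => exact fun _ _ _ => Iff.rfl
  | symm _ ih => exact fun φ p q => (ih φ p q).symm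
  | trans _ _ ih ih' => exact fun φ p q => (ih φ p q).trans (ih' φ p q)
  | @mul u v u' v' _ _ ih ih' =>
    intro φ p q
    have h1 := ih φ p ((letters u').flatMap φ ++ q)
    have h2 := ih' φ (p ++ (letters v).flatMap φ) q
    simp only [letters_mul, List.flatMap_append, List.append_assoc] at h1 h2 ⊢
    exact h1.trans h2
  | subst f _ ih =>
    intro φ p q
    rw [letters_lift, letters_lift, List.flatMap_assoc, List.flatMap_assoc]
    exact ih _ p q

theorem Valid.flatMap {N : Type*} [Monoid N] {u v : List ℕ} (h : Valid N u v) (φ : ℕ → List ℕ) :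
    Valid N (u.flatMap φ) (v.flatMap φ) := by
  have key : ∀ (f : ℕ → N) (w : List ℕ),
      ((w.flatMap φ).map f).prod = (w.map fun i => ((φ i).map f).prod).prod := by
    intro f w
    induction w with
    | nil => rfl
    | cons a w ih => simp [ih]
  intro f
  rw [key, key, h]

theorem pair_sublist_flatMap {s : List ℕ} {φ : ℕ → List ℕ} {a b x y : ℕ} (h : [a, b].Sublist s)
    (hx : x ∈ φ a) (hy : y ∈ φ b) : [x, y].Sublist (s.flatMap φ) := by
  have h1 : ∀ {l s : List ℕ}, l.Sublist s → (l.flatMap φ).Sublist (s.flatMap φ) := by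
    intro l s h
    induction h with
    | slnil => exact List.Sublist.refl _
    | cons c _ ih => exact ih.trans (List.sublist_append_right _ _)
    | cons_cons c _ ih => exact ih.append_left _
  refine List.Sublist.trans ?_ (h1 h)
  simpa using pair_sublist_append hx hy

/-- The word `1 1 2 2 ⋯ n n`. -/
def chain (n : ℕ) : List ℕ := (List.range' 1 n).flatMap fun i => [i, i]

/-- The word `x ^ m 1 1 2 2 ⋯ n n x`, with `x` the variable `0`. -/
def chainWord (m n : ℕ) : List ℕ := List.replicate m 0 ++ chain n ++ [0]

theorem mem_chain {n i : ℕ} : i ∈ chain n ↔ 1 ≤ i ∧ i ≤ n := by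
  simp only [chain, List.mem_flatMap, List.mem_range'_1, List.mem_cons, List.not_mem_nil, or_false,
    or_self, exists_eq_right']
  omega

theorem chain_pairwise (n : ℕ) : (chain n).Pairwise (· ≤ ·) := by
  refine List.pairwise_flatMap.2 ⟨fun a _ => by simp, ?_⟩
  refine List.Pairwise.imp (fun {a b} hab => ?_) (List.pairwise_lt_range' (s := 1) (n := n))
  simp only [List.mem_cons, List.not_mem_nil, or_false, or_self]
  rintro _ rfl _ rfl
  exact hab.le

theorem not_pair_sublist_chainWord {m n i j : ℕ} (hi : 1 ≤ i) (hij : i < j) :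
    ¬ [j, i].Sublist (chainWord m n) := by
  intro h
  have h1 := h.filter (· != 0)
  have h2 : (chainWord m n).filter (· != 0) = chain n := by
    have : (chain n).filter (· != 0) = chain n := List.filter_eq_self.2 fun a ha => by
      have := (mem_chain.1 ha).1
      simp
      omega
    simp [chainWord, this]
  have h3 : [j, i].filter (· != 0) = [j, i] := by
    have h4 : i ≠ 0 := by omega
    have h5 : j ≠ 0 := by omega
    simp [h4, h5]
  rw [h2, h3] at h1
  have := List.pairwise_iff_forall_sublist.1 (chain_pairwise n) h1
  omega

theorem count_chainWord (m n : ℕ) : (chainWord m n).count 0 = m + 1 := by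
  have : (chain n).count 0 = 0 := List.count_eq_zero.2 fun h => by simpa using mem_chain.1 h
  simp [chainWord, this]

theorem A01.valid_chainWord (m n : ℕ) (hm : 0 < m) :
    Valid A01 (chainWord m n) (0 :: chainWord m n) := by
  obtain ⟨k, rfl⟩ : ∃ k, m = k + 1 := ⟨m - 1, by omega⟩
  have key : ∀ k, Valid A01 (0 :: (List.replicate k 0 ++ chain n ++ [0]))
      (0 :: ((chain n).filter (· != 0) ++ [0])) := by
    intro k
    have h := A01.valid_filter_ne 0 (List.replicate k 0 ++ chain n)
    have e : (List.replicate k 0).filter (· != 0) = [] := by simp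
    rwa [List.filter_append, e, List.nil_append] at h
  simpa [chainWord, List.replicate_succ] using (key k).trans (key (k + 1)).symm

section

variable {α : Type*} {W : Set (FreeMonoid α)}

/-- In a value of the chain every letter occurs an even number of times. -/
theorem mem_tail_of_mem_chain_value (f : ℕ → List α) (L : List ℕ) {Y₁ Y₂ : List α} {b : α}
    (h : (L.flatMap fun i => [i, i]).flatMap f = Y₁ ++ b :: Y₂) (hb : b ∉ Y₁) : b ∈ Y₂ := by
  classical
  have heven : ∀ L : List ℕ, 2 ∣ ((L.flatMap fun i => [i, i]).flatMap f).count b := by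
    intro L
    induction L with
    | nil => simp
    | cons a L ih =>
      simp only [List.flatMap_cons, List.cons_append, List.nil_append, List.count_append]
      omega
  have := heven L
  rw [h, List.count_append, List.count_cons_self, List.count_eq_zero_of_not_mem hb] at this
  exact List.count_pos_iff.1 (by omega)

/-- The value of `0` occurs twice, so it is a power of a letter `a`. If the chain takes a value in
powers of `a`, an exponent above `m` results. Otherwise its first other letter `b` follows an `a`
and recurs by parity, giving a factor `a b ⋯ b ⋯ a` that σ₁ excludes. -/
theorem not_occurs_chainWord (hσ : SigmaLaws (SMon W)) {m : ℕ} (hm : maxExponent W = m)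
    (hm0 : 0 < m) (n : ℕ) (f : ℕ → List α) (hf : f 0 ≠ []) :
    ¬ Occurs W ((chainWord m n).flatMap f) := by
  classical
  intro hocc
  obtain ⟨m', rfl⟩ : ∃ j, m = j + 1 := ⟨m - 1, by omega⟩
  set Y := (chain n).flatMap f with hY
  have e : (chainWord (m' + 1) n).flatMap f =
      (List.replicate m' (f 0)).flatten ++ (f 0 ++ Y ++ f 0) := by
    simp [chainWord, List.flatMap_replicate, hY, List.replicate_succ']
  rw [e] at hocc
  obtain ⟨a, ha⟩ := hσ.eq_replicate hf (hocc.of_infix ⟨_, [], by rw [List.append_nil]⟩)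
  obtain ⟨k, hk⟩ : ∃ k, (f 0).length = k + 1 := ⟨(f 0).length - 1, by
    have := List.length_pos_iff.2 hf
    omega⟩
  rw [hk] at ha
  rw [ha] at hocc
  rcases hYa : Y.filter (· ≠ a) with _ | ⟨b, Y'⟩
  · have hYrep : Y = List.replicate Y.length a := List.eq_replicate_length.2 fun y hy => by
      simpa using List.filter_eq_nil_iff.1 hYa y hy
    rw [hYrep] at hocc
    simp only [List.flatten_replicate_replicate, ← List.replicate_add] at hocc
    have h1 := (le_maxExponent_iff (by omega)).2 ⟨a, hocc⟩
    rw [hm] at h1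
    have h2 : m' * (k + 1) + (k + 1 + Y.length + (k + 1)) ≤ m' + 1 := by exact_mod_cast h1
    nlinarith
  · obtain ⟨Y₁, Y₂, hY12, h1, h2, -⟩ := List.filter_eq_cons_iff.1 hYa
    have hba : a ≠ b := fun h => by simp [h] at h2
    have hY1 : Y₁ = List.replicate Y₁.length a := List.eq_replicate_length.2 fun y hy => by
      simpa using h1 y hy
    have hbY1 : b ∉ Y₁ := fun h => by
      rw [hY1] at h
      exact hba (List.eq_of_mem_replicate h).symm
    have hbY2 : b ∈ Y₂ := mem_tail_of_mem_chain_value f (List.range' 1 n) hY12 hbY1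
    obtain ⟨T, T', rfl⟩ := List.append_of_mem hbY2
    refine hσ.not_occurs' hba T T' (hocc.of_infix ?_)
    rw [hY12, hY1]
    refine ⟨(List.replicate m' (List.replicate (k + 1) a)).flatten ++
      List.replicate (k + Y₁.length) a, List.replicate k a, ?_⟩
    have e1 : List.replicate (k + 1) a ++ List.replicate Y₁.length a =
        List.replicate (k + Y₁.length) a ++ [a] := by
      rw [← List.replicate_add, ← List.replicate_succ']
      congr 1
      omega
    have e2 : List.replicate (k + 1) a = [a] ++ List.replicate k a := rfl
    calc _ = (List.replicate m' (List.replicate (k + 1) a)).flatten ++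
          ((List.replicate (k + Y₁.length) a ++ [a]) ++
            (b :: (T ++ b :: T') ++ ([a] ++ List.replicate k a))) := by
          simp only [List.append_assoc, List.cons_append, List.nil_append]
      _ = _ := by
        rw [← e1, ← e2]
        simp only [List.append_assoc]

theorem valid_chainWord (hσ : SigmaLaws (SMon W)) {m : ℕ} (hm : maxExponent W = m)
    (hm0 : 0 < m) (n : ℕ) : Valid (A01 × SMon W) (chainWord m n) (0 :: chainWord m n) := by
  refine Valid.prod.2 ⟨A01.valid_chainWord m n hm0, valid_sMon_iff.2 fun f => ?_⟩
  by_cases hf : f 0 = []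
  · left
    simp [hf]
  · have := not_occurs_chainWord hσ hm hm0 n f hf
    exact Or.inr ⟨this, fun h => this (h.of_infix ⟨f 0, [], by simp⟩)⟩

/-! ### Rewriting chain words by short identities -/

theorem count_flatMap_eq (s s' : List ℕ) (φ : ℕ → List ℕ) (x : ℕ)
    (hmem : ∀ z, z ∈ s ↔ z ∈ s') (h : ∀ z, x ∈ φ z → s.count z = s'.count z) :
    (s.flatMap φ).count x = (s'.flatMap φ).count x := by
  rw [List.count_flatMap, List.count_flatMap, Finset.sum_list_map_count,
    Finset.sum_list_map_count]
  have : s.toFinset = s'.toFinset := by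
    ext z
    simp [hmem]
  rw [this]
  refine Finset.sum_congr rfl fun z _ => ?_
  by_cases hz : x ∈ φ z
  · rw [h z hz]
  · simp [List.count_eq_zero_of_not_mem hz]

theorem count_flatMap_split (s : List ℕ) (φ : ℕ → List ℕ) (x z : ℕ) :
    (s.flatMap φ).count x =
      s.count z * (φ z).count x + ((s.filter (· != z)).flatMap φ).count x := by
  induction s with
  | nil => simp
  | cons a s ih =>
    by_cases haz : a = z
    · subst haz
      simp [ih]
      ring
    · simp [haz, ih]
      ring

theorem length_flatMap_two {z t : ℕ} (hzt : z ≠ t) (b : α) (T : List α) (s : List ℕ) :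
    (s.flatMap fun i => if i = z then [b] else if i = t then T else []).length =
      s.count z + s.count t * T.length := by
  induction s with
  | nil => simp
  | cons a s ih =>
    rw [List.flatMap_cons, List.length_append, ih]
    by_cases haz : a = z
    · subst haz
      simp [hzt]
      omega
    · by_cases hat : a = t
      · subst hat
        simp [haz]
        ring
      · simp [haz, hat]

theorem flatMap_two_of_notMem {z t : ℕ} (b : α) (T : List α) {s : List ℕ} (ht : t ∉ s) :
    (s.flatMap fun i => if i = z then [b] else if i = t then T else []) =
      List.replicate (s.count z) b := by
  induction s with
  | nil => simp
  | cons a s ih =>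
    simp only [List.mem_cons, not_or] at ht
    rw [List.flatMap_cons, ih ht.2]
    by_cases haz : a = z
    · simp [haz, List.replicate_succ]
    · simp [haz, Ne.symm ht.1]

/-- If all words `b ^ (m + 1 - d) T b ^ d` occur, a linear variable between the occurrences of `z`
prevents identities from changing the number of the latter, if this is `m + 1`. -/
theorem count_eq_of_linear_between {m : ℕ}
    (hW : ∀ d, 0 < d → d < m + 1 → ∃ (b : α) (T : List α),
      Occurs W (List.replicate (m + 1 - d) b ++ T ++ List.replicate d b))
    {s₁ s₂ s' : List ℕ} {z t : ℕ} (h : Valid (SMon W) (s₁ ++ t :: s₂) s') (hzt : z ≠ t)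
    (ht₁ : t ∉ s₁) (ht₂ : t ∉ s₂) (ht' : s'.count t = 1) (hz₁ : z ∈ s₁) (hz₂ : z ∈ s₂)
    (hz : s₁.count z + s₂.count z = m + 1) : s'.count z = m + 1 := by
  have h1 := List.count_pos_iff.2 hz₁
  have h2 := List.count_pos_iff.2 hz₂
  obtain ⟨b, T, hbT⟩ := hW (s₂.count z) h2 (by omega)
  have e : m + 1 - s₂.count z = s₁.count z := by omega
  rw [e] at hbT
  have hv := valid_sMon_iff.1 h fun i => if i = z then [b] else if i = t then T else []
  rw [List.flatMap_append, List.flatMap_cons, flatMap_two_of_notMem b T ht₁,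
    flatMap_two_of_notMem b T ht₂] at hv
  simp only [hzt.symm, if_false, if_true, ← List.append_assoc] at hv
  -- The left value occurs in W, so both values are the same word; as `t` is linear in `s'`,
  -- comparing lengths isolates the multiplicity of `z`.
  have hv' := hv.resolve_right fun h => h.1 hbT
  have hlen := congrArg List.length hv'
  rw [length_flatMap_two hzt, ht'] at hlen
  simp only [List.length_append, List.length_replicate] at hlen
  omega

theorem count_preserved {m K : ℕ} (hm : maxExponent W = m) (hm0 : 0 < m)
    (hW : ∀ d, 0 < d → d < m + 1 → ∃ (b : α) (T : List α),
      Occurs W (List.replicate (m + 1 - d) b ++ T ++ List.replicate d b))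
    {s s' : List ℕ} (hs : Valid (A01 × SMon W) s s') (hlen : s.length ≤ K) (φ : ℕ → List ℕ)
    (p q : List ℕ) (hA : Valid A01 (chainWord m (K + 3)) (p ++ s.flatMap φ ++ q))
    (hc : (p ++ s.flatMap φ ++ q).count 0 = m + 1) :
    (p ++ s'.flatMap φ ++ q).count 0 = m + 1 := by
  obtain ⟨hsA, hsS⟩ := Valid.prod.1 hs
  have hmem := ((A01.valid_iff _ _).1 hsA).1
  rw [A01.valid_iff] at hA
  by_cases hbal : ∀ z, 0 ∈ φ z → s.count z = s'.count z
  · rw [← hc, List.count_append, List.count_append, List.count_append, List.count_append,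
      count_flatMap_eq s s' φ 0 hmem hbal]
  push Not at hbal
  obtain ⟨z, hz0, hz⟩ := hbal
  have hzs : z ∈ s := by
    by_contra hzs
    rw [List.count_eq_zero_of_not_mem hzs,
      List.count_eq_zero_of_not_mem fun h => hzs ((hmem z).2 h)] at hz
    exact hz rfl
  have hzm := (count_eq_or_lt hsS (List.count_pos_iff.2 hzs)
    (List.count_pos_iff.2 ((hmem z).1 hzs))).resolve_left hz
  have hzm' : m + 1 ≤ s.count z := by
    have := hzm.1
    rw [hm] at this
    exact_mod_cast this
  have hφz := List.count_pos_iff.2 hz0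
  have hle : s.count z ≤ s.count z * (φ z).count 0 := Nat.le_mul_of_pos_right _ hφz
  rw [List.count_append, List.count_append, count_flatMap_split s φ 0 z] at hc
  -- The variable `z` already accounts for at least `m + 1` occurrences of `0`, which is all of
  -- them; none is left for `p`, `q` or the other variables.
  have hzc : s.count z = m + 1 := by omega
  have hp0 : 0 ∉ p := List.count_eq_zero.1 (by omega)
  have hq0 : 0 ∉ q := List.count_eq_zero.1 (by omega)
  have hother : ∀ y ∈ s, y ≠ z → 0 ∉ φ y := by
    intro y hy hyz h0
    have : 0 ∉ (s.filter (· != z)).flatMap φ := List.count_eq_zero.1 (by omega)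
    exact this (List.mem_flatMap.2 ⟨y, by simp [hy, hyz], h0⟩)
  have h01 : [0, 1].Sublist (p ++ s.flatMap φ ++ q) := by
    rw [← hA.2, chainWord, List.append_assoc]
    exact pair_sublist_append (by simp; omega) (by simp [mem_chain])
  have hn0 : [K + 3, 0].Sublist (p ++ s.flatMap φ ++ q) := by
    rw [← hA.2, chainWord]
    exact pair_sublist_append (by simp [mem_chain]) (by simp)
  have hord : ∀ i j, 1 ≤ i → i < j → ¬ [j, i].Sublist (p ++ s.flatMap φ ++ q) := by
    intro i j hi hij h
    rw [← hA.2] at h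
    exact not_pair_sublist_chainWord hi hij h
  -- Some `0` precedes a `1`, and no `i > 1` precedes a `1`; so `i` cannot lie in a prefix free of
  -- `0`. The right end is handled likewise with `K + 3`.
  have hleft : ∀ i P R, 1 < i → p ++ s.flatMap φ ++ q = P ++ R → 0 ∉ P → i ∉ P := by
    intro i P R hi he h0 hiP
    rw [he] at h01
    refine not_pair_sublist h0 (fun h1 => hord 1 i le_rfl hi ?_) h01
    rw [he]
    exact pair_sublist_append hiP h1
  have hright : ∀ i P R, 1 ≤ i → i < K + 3 → p ++ s.flatMap φ ++ q = P ++ R → 0 ∉ R → i ∉ R := by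
    intro i P R hi hiK he h0 hiR
    rw [he] at hn0
    refine not_pair_sublist (fun h1 => hord i (K + 3) hi hiK ?_) h0 hn0
    rw [he]
    exact pair_sublist_append h1 hiR
  -- Since `1` and `K + 3` serve to locate `0`, the `K + 1` variables `2, …, K + 2` remain, one more
  -- than the length of `s` allows.
  have hcover : ∀ i : Fin (K + 1), ∃ t ∈ s, (i : ℕ) + 2 ∈ φ t := by
    intro i
    have hi := i.2
    have h1 : (i : ℕ) + 2 ∈ p ++ s.flatMap φ ++ q := by
      rw [← hA.1, chainWord]
      simp [mem_chain]
    have h2 := hleft (i + 2) p (s.flatMap φ ++ q) (by omega) (List.append_assoc _ _ _) hp0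
    have h3 := hright (i + 2) (p ++ s.flatMap φ) q (by omega) (by omega) rfl hq0
    simp only [List.mem_append, h2, h3, or_false, false_or, List.mem_flatMap] at h1
    exact h1
  choose t hts hit using hcover
  obtain ⟨i, hi⟩ : ∃ i, s.count (t i) = 1 := by
    by_contra hcon
    push Not at hcon
    -- A variable occurring twice in `s` and covering both `i + 2` and `j + 2` would put the larger
    -- before the smaller.
    have hinj : Function.Injective t := by
      have key : ∀ i j : Fin (K + 1), i < j → t i ≠ t j := by
        intro i j hij he
        have h1 : [t i, t i].Sublist s := by
          rw [← two_le_count_iff]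
          have := List.count_pos_iff.2 (hts i)
          have := hcon i
          omega
        have hij' : (i : ℕ) < j := hij
        refine hord (i + 2) (j + 2) (by omega) (by omega) ?_
        have h2 := pair_sublist_flatMap (φ := φ) h1 (he ▸ hit j) (hit i)
        exact (h2.trans (List.sublist_append_right _ _)).trans (List.sublist_append_left _ _)
      intro i j he
      rcases lt_trichotomy i j with h | h | h
      · exact absurd he (key i j h)
      · exact h
      · exact absurd he.symm (key j i h)
    have hcard := Finset.card_le_card_of_injOn (s := Finset.univ) (t := s.toFinset) t
      (fun i _ => by simpa using hts i) hinj.injOn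
    rw [Finset.card_univ, Fintype.card_fin] at hcard
    have := List.toFinset_card_le s
    omega
  have hbound := i.2
  have hzt : z ≠ t i := by
    intro h
    rw [← h] at hi
    omega
  have hφt : 0 ∉ φ (t i) := hother _ (hts i) hzt.symm
  obtain ⟨s₁, s₂, rfl, ht₁, ht₂⟩ := exists_eq_append_of_count_eq_one hi
  have hnot : ∀ r : List ℕ, (∀ y ∈ r, y ∈ s₁ ++ t i :: s₂) → z ∉ r → 0 ∉ r.flatMap φ := by
    intro r hr hz' h0
    obtain ⟨y, hy, hy0⟩ := List.mem_flatMap.1 h0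
    exact hother y (hr y hy) (fun h => hz' (h ▸ hy)) hy0
  have hz₁ : z ∈ s₁ := by
    by_contra hz₁
    refine hleft (i + 2) (p ++ s₁.flatMap φ ++ φ (t i)) (s₂.flatMap φ ++ q) (by omega) (by simp) ?_
      (by simp [hit])
    have := hnot s₁ (fun y hy => by simp [hy]) hz₁
    simp only [List.mem_append, hp0, this, hφt, or_self, not_false_eq_true]
  have hz₂ : z ∈ s₂ := by
    by_contra hz₂
    refine hright (i + 2) (p ++ s₁.flatMap φ) (φ (t i) ++ (s₂.flatMap φ ++ q)) (by omega)
      (by omega) (by simp) ?_ (by simp [hit])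
    have := hnot s₂ (fun y hy => by simp [hy]) hz₂
    simp only [List.mem_append, hq0, this, hφt, or_self, not_false_eq_true]
  have hsum : s₁.count z + s₂.count z = m + 1 := by
    rw [← hzc, List.count_append, List.count_cons_of_ne hzt.symm]
  have := count_eq_of_linear_between hW hsS hzt ht₁ ht₂ (A01.count_eq_one hsA hi) hz₁ hz₂ hsum
  exact absurd (hzc.trans this.symm) hz

theorem not_isFinitelyBased (hσ : SigmaLaws (SMon W)) {m : ℕ} (hm : maxExponent W = m)
    (hm0 : 0 < m)
    (hW : ∀ d, 0 < d → d < m + 1 → ∃ (b : α) (T : List α),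
      Occurs W (List.replicate (m + 1 - d) b ++ T ++ List.replicate d b)) :
    ¬ IsFinitelyBased (A01 × SMon W) := by
  rintro ⟨B, hB, hfin, hder⟩
  obtain ⟨K, hK⟩ : ∃ K, ∀ e ∈ B, (letters e.1).length ≤ K ∧ (letters e.2).length ≤ K := by
    obtain ⟨K, hK⟩ := (hfin.image fun e => (letters e.1).length + (letters e.2).length).bddAbove
    refine ⟨K, fun e he => ?_⟩
    have := hK (Set.mem_image_of_mem _ he)
    omega
  obtain ⟨U, hU⟩ := exists_letters_eq (u := chainWord m (K + 3)) (by simp [chainWord])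
  obtain ⟨V, hV⟩ := exists_letters_eq (u := 0 :: chainWord m (K + 3)) (by simp)
  have hUV : (U, V) ∈ equationalTheory (A01 × SMon W) := by
    refine (satisfies_iff_valid _).2 ?_
    rw [hU, hV]
    exact valid_chainWord hσ hm hm0 _
  -- This invariant holds for the left side of the chain identity and fails for the right side,
  -- which has `m + 2` occurrences of `0`.
  set I : List ℕ → Prop := fun w => Valid A01 (chainWord m (K + 3)) w ∧ w.count 0 = m + 1 with hI
  have half : ∀ s s' : List ℕ, Valid (A01 × SMon W) s s' → s.length ≤ K →
      ∀ (φ : ℕ → List ℕ) (p q : List ℕ),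
        I (p ++ s.flatMap φ ++ q) → I (p ++ s'.flatMap φ ++ q) := by
    rintro s s' hs hlen φ p q ⟨h1, h2⟩
    refine ⟨h1.trans ?_, count_preserved hm hm0 hW hs hlen φ p q h1 h2⟩
    exact (((Valid.prod.1 hs).1.flatMap φ).append_left p).append_right q
  have := (hder _ hUV).preserves I (fun e he φ p q => by
    have hs := (satisfies_iff_valid e).1 (hB he)
    exact ⟨half _ _ hs (hK e he).1 φ p q, half _ _ hs.symm (hK e he).2 φ p q⟩)
    (fun i => [i]) [] []
  simp only [hU, hV, List.nil_append, List.append_nil, List.flatMap_singleton'] at this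
  have h1 := (this.1 ⟨.refl _, count_chainWord m _⟩).2
  rw [List.count_cons_self, count_chainWord] at h1
  omega

end


/-! ## The criterion -/

section

variable {α : Type*} {W : Set (FreeMonoid α)}

theorem sigmaLaws_of_satisfies {N : Type*} [Monoid N] (h₁ : Satisfies N sigma1)
    (h₂ : Satisfies N sigma2) : SigmaLaws N :=
  sigmaLaws_iff.2 ⟨(satisfies_iff_valid _).1 h₁, (satisfies_iff_valid _).1 h₂⟩

theorem isFinitelyBased_iff (hW : ∃ w ∈ W, w ≠ 1) (hσ : SigmaLaws (SMon W)) :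
    IsFinitelyBased (A01 × SMon W) ↔ maxExponent W = ⊤ ∨
      ∃ m : ℕ, maxExponent W = m ∧ ∃ d : ℕ, 0 < d ∧ d < m + 1 ∧
        ∀ (b : α) (T : List α), T ≠ [] →
          ¬ Occurs W (List.replicate (m + 1 - d) b ++ T ++ List.replicate d b) := by
  refine ⟨fun h => ?_, isFinitelyBased_of_condition hσ⟩
  by_contra hcon
  push Not at hcon
  obtain ⟨m, hm⟩ := ENat.ne_top_iff_exists.1 hcon.1
  have hm0 : 0 < m := by
    have := maxExponent_pos hW
    rw [← hm] at this
    exact_mod_cast this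
  refine not_isFinitelyBased hσ hm.symm hm0 (fun d hd hdm => ?_) h
  obtain ⟨b, T, -, hT⟩ := hcon.2 m hm.symm d hd hdm
  exact ⟨b, T, hT⟩

theorem occurs_iff_exists_isSubword (p q : ℕ) (b : α) (T : FreeMonoid α) :
    Occurs W (List.replicate p b ++ FreeMonoid.toList T ++ List.replicate q b) ↔
      ∃ w ∈ W, IsSubword (FreeMonoid.of b ^ p * T * FreeMonoid.of b ^ q) w := by
  rw [of_pow_eq, of_pow_eq]
  rfl

end

/-! ## The decision procedure -/

theorem occurs_wordSet {L : List (List ℕ)} {l : List ℕ} :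
    Occurs (wordSet L) l ↔ ∃ w ∈ L, l <:+: w := by
  constructor
  · rintro ⟨w, hw, p, q, h⟩
    exact ⟨_, hw, FreeMonoid.toList p, FreeMonoid.toList q, (congrArg FreeMonoid.toList h).symm⟩
  · rintro ⟨w, hw, p, q, h⟩
    exact ⟨FreeMonoid.ofList w, hw, FreeMonoid.ofList p, FreeMonoid.ofList q,
      (congrArg FreeMonoid.ofList h).symm⟩

/-- The word `w` contains `b ^ p` at position `i`. -/
def PowerAt (w : List ℕ) (b p i : ℕ) : Prop := ∀ k < p, w[i + k]? = some b

theorem PowerAt.drop_eq {w : List ℕ} {b p i : ℕ} (h : PowerAt w b p i) :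
    w.drop i = List.replicate p b ++ w.drop (i + p) := by
  induction p generalizing i with
  | zero => simp
  | succ p ih =>
    obtain ⟨hi, h0⟩ := List.getElem?_eq_some_iff.1 (h 0 (by omega))
    have h1 : PowerAt w b p (i + 1) := fun k hk => by
      rw [add_assoc, add_comm 1 k]
      exact h (k + 1) (by omega)
    rw [List.drop_eq_getElem_cons (by simpa using hi), ih h1, List.replicate_succ]
    simp only [add_zero] at h0
    rw [h0, List.cons_append]
    congr 3
    omega

theorem PowerAt.lt_length {w : List ℕ} {b p i : ℕ} (h : PowerAt w b p i) (hp : 0 < p) :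
    i < w.length := by
  obtain ⟨hi, -⟩ := List.getElem?_eq_some_iff.1 (h 0 hp)
  simpa using hi

theorem powerAt_append (s t : List ℕ) (b p : ℕ) :
    PowerAt (s ++ List.replicate p b ++ t) b p s.length := by
  intro k hk
  rw [List.append_assoc, List.getElem?_append_right (by omega), Nat.add_sub_cancel_left,
    List.getElem?_append_left (by simpa using hk)]
  simp [hk]

theorem replicate_infix_iff {w : List ℕ} {b p : ℕ} (hp : 0 < p) :
    List.replicate p b <:+: w ↔ ∃ i < w.length, PowerAt w b p i := by
  constructor
  · rintro ⟨s, t, rfl⟩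
    exact ⟨_, (powerAt_append s t b p).lt_length hp, powerAt_append s t b p⟩
  · rintro ⟨i, -, h⟩
    refine ⟨w.take i, w.drop (i + p), ?_⟩
    rw [List.append_assoc, ← h.drop_eq, List.take_append_drop]

/-- The strict inequality `i + p < j` between positions expresses that `T` is nonempty. -/
theorem gap_infix_iff {w : List ℕ} {b p q : ℕ} (hp : 0 < p) (hq : 0 < q) :
    (∃ T : List ℕ, T ≠ [] ∧ List.replicate p b ++ T ++ List.replicate q b <:+: w) ↔
      ∃ i < w.length, ∃ j < w.length, i + p < j ∧ PowerAt w b p i ∧ PowerAt w b q j := by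
  constructor
  · rintro ⟨T, hT, s, t, rfl⟩
    have h1 := powerAt_append s (T ++ List.replicate q b ++ t) b p
    have h2 := powerAt_append (s ++ List.replicate p b ++ T) t b q
    simp only [← List.append_assoc] at h1 h2 ⊢
    have := List.length_pos_iff.2 hT
    exact ⟨_, h1.lt_length hp, _, h2.lt_length hq, by simp; omega, h1, h2⟩
  · rintro ⟨i, -, j, hj, hij, h1, h2⟩
    refine ⟨(w.drop (i + p)).take (j - (i + p)), ?_, w.take i, w.drop (j + q), ?_⟩
    · rw [← List.length_pos_iff, List.length_take, List.length_drop]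
      omega
    · have e : w.drop j = (w.drop (i + p)).drop (j - (i + p)) := by
        rw [List.drop_drop]
        congr 1
        omega
      simp only [List.append_assoc]
      rw [← h2.drop_eq, e, List.take_append_drop, ← h1.drop_eq, List.take_append_drop]

/-- Some word of `L` contains the `m`-th power of a letter. -/
def HasPower (L : List (List ℕ)) (m : ℕ) : Prop :=
  ∃ w ∈ L, ∃ b ∈ w, ∃ i < w.length, PowerAt w b m i

/-- Some word of `L` contains `b ^ p T b ^ q` for a letter `b` and a nonempty word `T`. -/
def HasGap (L : List (List ℕ)) (p q : ℕ) : Prop :=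
  ∃ w ∈ L, ∃ b ∈ w, ∃ i < w.length, ∃ j < w.length,
    i + p < j ∧ PowerAt w b p i ∧ PowerAt w b q j

/-- The bounded form of the criterion for finite sets of words. -/
def FiniteCondition (L : List (List ℕ)) : Prop :=
  ∃ m < L.flatten.length + 1, 0 < m ∧ HasPower L m ∧ ¬ HasPower L (m + 1) ∧
    ∃ d < m + 1, 0 < d ∧ ¬ HasGap L (m + 1 - d) d

theorem hasPower_iff {L : List (List ℕ)} {m : ℕ} (hm : 0 < m) :
    HasPower L m ↔ ∃ b, Occurs (wordSet L) (List.replicate m b) := by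
  constructor
  · rintro ⟨w, hw, b, -, h⟩
    exact ⟨b, occurs_wordSet.2 ⟨w, hw, (replicate_infix_iff hm).2 h⟩⟩
  · rintro ⟨b, h⟩
    obtain ⟨w, hw, h⟩ := occurs_wordSet.1 h
    exact ⟨w, hw, b, h.subset (by simp; omega), (replicate_infix_iff hm).1 h⟩

theorem hasGap_iff {L : List (List ℕ)} {p q : ℕ} (hp : 0 < p) (hq : 0 < q) :
    HasGap L p q ↔ ∃ (b : ℕ) (T : List ℕ), T ≠ [] ∧
      Occurs (wordSet L) (List.replicate p b ++ T ++ List.replicate q b) := by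
  constructor
  · rintro ⟨w, hw, b, -, h⟩
    obtain ⟨T, hT, h⟩ := (gap_infix_iff hp hq).2 h
    exact ⟨b, T, hT, occurs_wordSet.2 ⟨w, hw, h⟩⟩
  · rintro ⟨b, T, hT, h⟩
    obtain ⟨w, hw, h⟩ := occurs_wordSet.1 h
    exact ⟨w, hw, b, h.subset (by simp; omega), (gap_infix_iff hp hq).1 ⟨T, hT, h⟩⟩

theorem HasPower.le_length {L : List (List ℕ)} {m : ℕ} (h : HasPower L m) :
    m ≤ L.flatten.length := by
  rcases Nat.eq_zero_or_pos m with rfl | hm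
  · exact Nat.zero_le _
  obtain ⟨b, h⟩ := (hasPower_iff hm).1 h
  obtain ⟨w, hw, h⟩ := occurs_wordSet.1 h
  have h1 := h.length_le
  have h2 := (List.sublist_flatten_of_mem hw).length_le
  rw [List.length_replicate] at h1
  omega

theorem finiteCondition_iff {L : List (List ℕ)} (hL : ∃ w ∈ L, w ≠ []) :
    FiniteCondition L ↔ maxExponent (wordSet L) = ⊤ ∨
      ∃ m : ℕ, maxExponent (wordSet L) = m ∧ ∃ d : ℕ, 0 < d ∧ d < m + 1 ∧
        ∀ (b : ℕ) (T : List ℕ), T ≠ [] →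
          ¬ Occurs (wordSet L) (List.replicate (m + 1 - d) b ++ T ++ List.replicate d b) := by
  have hle : ∀ {m : ℕ}, 0 < m → (HasPower L m ↔ (m : ℕ∞) ≤ maxExponent (wordSet L)) :=
    fun hm => (hasPower_iff hm).trans (le_maxExponent_iff hm).symm
  have hmax : ∀ {m : ℕ}, 0 < m →
      (HasPower L m ∧ ¬ HasPower L (m + 1) ↔ maxExponent (wordSet L) = m) := by
    intro m hm
    rw [hle hm, hle (Nat.succ_pos m), not_le]
    constructor
    · rintro ⟨h1, h2⟩
      refine le_antisymm ?_ h1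
      rw [Nat.cast_succ] at h2
      exact Order.le_of_lt_add_one h2
    · intro h
      rw [h]
      exact ⟨le_rfl, by exact_mod_cast Nat.lt_succ_self m⟩
  have hgap : ∀ {m d : ℕ}, 0 < d → d < m + 1 → (¬ HasGap L (m + 1 - d) d ↔
      ∀ (b : ℕ) (T : List ℕ), T ≠ [] →
        ¬ Occurs (wordSet L) (List.replicate (m + 1 - d) b ++ T ++ List.replicate d b)) := by
    intro m d hd hdm
    rw [hasGap_iff (by omega) hd]
    push Not
    rfl
  constructor
  · rintro ⟨m, -, hm0, h1, h2, d, hdm, hd, h3⟩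
    exact Or.inr ⟨m, (hmax hm0).1 ⟨h1, h2⟩, d, hd, hdm, (hgap hd hdm).1 h3⟩
  · rintro (h | ⟨m, hm, d, hd, hdm, h⟩)
    -- Exponents are bounded by the total length of `L`, so the infinite case cannot arise.
    · have := ((hle (Nat.succ_pos L.flatten.length)).2 (by rw [h]; exact le_top)).le_length
      omega
    · have hm0 : 0 < m := by
        have := maxExponent_pos (W := wordSet L)
          (by obtain ⟨w, hw, hw'⟩ := hL; exact ⟨FreeMonoid.ofList w, hw, hw'⟩)
        rw [hm] at this
        exact_mod_cast this
      obtain ⟨h1, h2⟩ := (hmax hm0).2 hm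
      exact ⟨m, Nat.lt_succ_of_le h1.le_length, hm0, h1, h2, d, hdm, hd, (hgap hd hdm).2 h⟩

/-! ### Primitive recursiveness of the bounded criterion -/

theorem primrecPred_exists_lt {β : Type} [Primcodable β] {R : ℕ → β → Prop} (h : PrimrecRel R)
    {n : β → ℕ} (hn : Primrec n) : PrimrecPred fun c => ∃ i < n c, R i c :=
  (h.exists_mem_list.comp (Primrec.list_range.comp hn) Primrec.id).of_eq (by simp)

theorem primrecPred_forall_lt {β : Type} [Primcodable β] {R : ℕ → β → Prop} (h : PrimrecRel R)
    {n : β → ℕ} (hn : Primrec n) : PrimrecPred fun c => ∀ i < n c, R i c :=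
  (h.forall_mem_list.comp (Primrec.list_range.comp hn) Primrec.id).of_eq (by simp)

open Primrec in
theorem primrec_powerAt {β : Type} [Primcodable β] {w : β → List ℕ} {b p i : β → ℕ}
    (hw : Primrec w) (hb : Primrec b) (hp : Primrec p) (hi : Primrec i) :
    PrimrecPred fun c => PowerAt (w c) (b c) (p c) (i c) := by
  have h : PrimrecRel fun (k : ℕ) (c : β) => (w c)[i c + k]? = some (b c) :=
    Primrec.eq.comp
      (list_getElem?.comp (hw.comp snd) (nat_add.comp (hi.comp snd) fst))
      (option_some.comp (hb.comp snd))
  exact primrecPred_forall_lt h hp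

open Primrec in
theorem primrec_hasPower : PrimrecRel HasPower := by
  have h1 : PrimrecRel fun (i : ℕ) (c : ℕ × List ℕ × ℕ) => PowerAt c.2.1 c.1 c.2.2 i :=
    primrec_powerAt (fst.comp (snd.comp snd)) (fst.comp snd) (snd.comp (snd.comp snd)) fst
  have h2 : PrimrecRel fun (b : ℕ) (c : List ℕ × ℕ) => ∃ i < c.1.length, PowerAt c.1 b c.2 i :=
    primrecPred_exists_lt h1 (list_length.comp (fst.comp snd))
  have h3 : PrimrecRel fun (w : List ℕ) (m : ℕ) => ∃ b ∈ w, ∃ i < w.length, PowerAt w b m i :=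
    h2.exists_mem_list.comp fst Primrec.id
  exact h3.exists_mem_list

open Primrec in
theorem primrec_hasGap :
    PrimrecPred fun c : List (List ℕ) × ℕ × ℕ => HasGap c.1 c.2.1 c.2.2 := by
  have h1 : PrimrecRel fun (j : ℕ) (c : ℕ × ℕ × List ℕ × ℕ × ℕ) =>
      c.1 + c.2.2.2.1 < j ∧ PowerAt c.2.2.1 c.2.1 c.2.2.2.1 c.1 ∧
        PowerAt c.2.2.1 c.2.1 c.2.2.2.2 j := by
    have hw : Primrec fun c : ℕ × ℕ × ℕ × List ℕ × ℕ × ℕ => c.2.2.2.1 :=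
      fst.comp (snd.comp (snd.comp snd))
    have hp : Primrec fun c : ℕ × ℕ × ℕ × List ℕ × ℕ × ℕ => c.2.2.2.2.1 :=
      fst.comp (snd.comp (snd.comp (snd.comp snd)))
    have hq : Primrec fun c : ℕ × ℕ × ℕ × List ℕ × ℕ × ℕ => c.2.2.2.2.2 :=
      snd.comp (snd.comp (snd.comp (snd.comp snd)))
    have hb : Primrec fun c : ℕ × ℕ × ℕ × List ℕ × ℕ × ℕ => c.2.2.1 := fst.comp (snd.comp snd)
    have hi : Primrec fun c : ℕ × ℕ × ℕ × List ℕ × ℕ × ℕ => c.2.1 := fst.comp snd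
    exact (nat_lt.comp (nat_add.comp hi hp) fst).and
      ((primrec_powerAt hw hb hp hi).and (primrec_powerAt hw hb hq fst))
  have h2 : PrimrecRel fun (i : ℕ) (c : ℕ × List ℕ × ℕ × ℕ) => ∃ j < c.2.1.length,
      i + c.2.2.1 < j ∧ PowerAt c.2.1 c.1 c.2.2.1 i ∧ PowerAt c.2.1 c.1 c.2.2.2 j :=
    primrecPred_exists_lt h1 (list_length.comp (fst.comp (snd.comp snd)))
  have h3 : PrimrecRel fun (b : ℕ) (c : List ℕ × ℕ × ℕ) => ∃ i < c.1.length, ∃ j < c.1.length,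
      i + c.2.1 < j ∧ PowerAt c.1 b c.2.1 i ∧ PowerAt c.1 b c.2.2 j :=
    primrecPred_exists_lt h2 (list_length.comp (fst.comp snd))
  have h4 : PrimrecRel fun (w : List ℕ) (c : ℕ × ℕ) => ∃ b ∈ w, ∃ i < w.length, ∃ j < w.length,
      i + c.1 < j ∧ PowerAt w b c.1 i ∧ PowerAt w b c.2 j :=
    h3.exists_mem_list.comp fst Primrec.id
  exact h4.exists_mem_list

open Primrec in
theorem primrec_finiteCondition : PrimrecPred FiniteCondition := by
  have h1 : PrimrecRel fun (d : ℕ) (c : ℕ × List (List ℕ)) =>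
      0 < d ∧ ¬ HasGap c.2 (c.1 + 1 - d) d :=
    (nat_lt.comp (const 0) fst).and (primrec_hasGap.comp
      ((snd.comp snd).pair ((nat_sub.comp (succ.comp (fst.comp snd)) fst).pair fst))).not
  have h2 : PrimrecRel fun (m : ℕ) (L : List (List ℕ)) =>
      ∃ d < m + 1, 0 < d ∧ ¬ HasGap L (m + 1 - d) d :=
    primrecPred_exists_lt h1 (succ.comp fst)
  have h3 : PrimrecRel fun (m : ℕ) (L : List (List ℕ)) => 0 < m ∧ HasPower L m ∧
      ¬ HasPower L (m + 1) ∧ ∃ d < m + 1, 0 < d ∧ ¬ HasGap L (m + 1 - d) d :=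
    (nat_lt.comp (const 0) fst).and ((primrec_hasPower.comp snd fst).and
      ((primrec_hasPower.comp snd (succ.comp fst)).not.and h2))
  exact primrecPred_exists_lt h3 (succ.comp (list_length.comp list_flatten))

end FBMonoid

/-! ### The criterion and the algorithm -/

theorem mainTheorem4 :
    (∀ {α : Type*} (W : Set (FreeMonoid α)),
      (∃ w ∈ W, w ≠ 1) →
      FBMonoid.Satisfies (FBMonoid.SMon W) FBMonoid.sigma1 →
      FBMonoid.Satisfies (FBMonoid.SMon W) FBMonoid.sigma2 →
      (FBMonoid.IsFinitelyBased (FBMonoid.A01 × FBMonoid.SMon W) ↔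
        FBMonoid.maxExponent W = ⊤ ∨
        ∃ m : ℕ, FBMonoid.maxExponent W = m ∧
          ∃ d : ℕ, 0 < d ∧ d < m + 1 ∧
            ∀ (b : α) (T : FreeMonoid α), T ≠ 1 →
              ∀ w ∈ W, ¬ FBMonoid.IsSubword
                (FreeMonoid.of b ^ (m + 1 - d) * T * FreeMonoid.of b ^ d) w)) ∧
    (∃ alg : List (List ℕ) → Bool, Computable alg ∧
      ∀ L : List (List ℕ),
        (∃ w ∈ L, w ≠ []) →
        FBMonoid.Satisfies (FBMonoid.SMon (FBMonoid.wordSet L)) FBMonoid.sigma1 →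
        FBMonoid.Satisfies (FBMonoid.SMon (FBMonoid.wordSet L)) FBMonoid.sigma2 →
        (alg L = true ↔
          FBMonoid.IsFinitelyBased (FBMonoid.A01 × FBMonoid.SMon (FBMonoid.wordSet L)))) := by
  constructor
  · intro α W hW h₁ h₂
    rw [FBMonoid.isFinitelyBased_iff hW (FBMonoid.sigmaLaws_of_satisfies h₁ h₂)]
    have key : ∀ m d : ℕ, (∀ (b : α) (T : List α), T ≠ [] → ¬ FBMonoid.Occurs W
        (List.replicate (m + 1 - d) b ++ T ++ List.replicate d b)) ↔
        ∀ (b : α) (T : FreeMonoid α), T ≠ 1 → ∀ w ∈ W, ¬ FBMonoid.IsSubword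
          (FreeMonoid.of b ^ (m + 1 - d) * T * FreeMonoid.of b ^ d) w := by
      intro m d
      constructor
      · intro h b T hT w hw hsub
        exact h b (FreeMonoid.toList T) hT
          ((FBMonoid.occurs_iff_exists_isSubword _ _ b T).2 ⟨w, hw, hsub⟩)
      · intro h b T hT hocc
        obtain ⟨w, hw, hsub⟩ :=
          (FBMonoid.occurs_iff_exists_isSubword _ _ b (FreeMonoid.ofList T)).1 hocc
        exact h b (FreeMonoid.ofList T) hT w hw hsub
    simp only [key]
  · obtain ⟨_, hprim⟩ := FBMonoid.primrec_finiteCondition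
    refine ⟨fun L => decide (FBMonoid.FiniteCondition L), hprim.to_comp, fun L hL h₁ h₂ => ?_⟩
    have hW : ∃ w ∈ FBMonoid.wordSet L, w ≠ 1 := by
      obtain ⟨w, hw, hw'⟩ := hL
      exact ⟨FreeMonoid.ofList w, hw, hw'⟩
    rw [decide_eq_true_iff, FBMonoid.finiteCondition_iff hL,
      FBMonoid.isFinitelyBased_iff hW (FBMonoid.sigmaLaws_of_satisfies h₁ h₂)]
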